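/- Let $d\ge 2$ be an integer, $1<p<d$, $p^\star=\frac{pd}{d-p}$ and $\eta>0$. There is a constant $C>0$, depending only on $d$, $p$ and $\eta$, such that the following holds. Let $\Omega\subset\mathbb{R}^d$ be a bounded connected open set that is polyhedral (its boundary is a finite union of subsets of hyperplanes). Let $\mathcal D=(\mathcal M,\mathcal E,\mathcal P)$ be a discretisation of $\Omega$, that is: * $\mathcal M$ is a finite family of nonempty connected open pairwise disjoint subsets of $\Omega$ with $\overline\Omega=\bigcup_{K\in\mathcal M}\overline K$; * $\mathcal E$ is a finite family of pairwise disjoint subsets of $\overline\Omega$; each $\sigma\in\mathcal E$ is a nonempty relatively open subset of a hyperplane, its $(d-1)$-dimensional measure $|\sigma|$ is positive, and $\overline\sigma\setminus\sigma$ has $(d-1)$-dimensional measure zero; for each $K\in\mathcal M$ a subset $\mathcal E_K\subset\mathcal E$ is given with $\partial K=\bigcup_{\sigma\in\mathcal E_K}\overline\sigma$; and, with $\mathcal M_\sigma=\{K\in\mathcal M:\sigma\in\mathcal E_K\}$, for each $\sigma\in\mathcal E$ either $\mathcal M_\sigma$ has exactly one element and $\sigma\subset\partial\Omega$, or $\mathcal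 M_\sigma$ has exactly two elements; * $\mathcal P=(x_K)_{K\in\mathcal M}$ is a family of points with $x_K\in K$ such that $K$ is star-shaped with respect to $x_K$ and, for every $\sigma\in\mathcal E_K$, the Euclidean distance $d_{K,\sigma}$ from $x_K$ to the hyperplane containing $\sigma$ is positive. Assume that $\eta\le d_{K,\sigma}/d_{L,\sigma}\le 1/\eta$ for all $\sigma\in\mathcal E$ with $\mathcal M_\sigma=\{K,L\}$, $K\ne L$. Then every function $u$ on $\Omega$ that is (almost everywhere) equal to a constant $u_K$ on each $K\in\mathcal M$ satisfies $$\|u\|_{L^{p^\star}(\Omega)}\le C\,\|u\|_{1,p,\mathcal M},\qquad \|u\|_{1,p,\mathcal M}^p=\sum_{K\in\mathcal M}\sum_{\sigma\in\mathcal E_K}|\sigma|\,d_{K,\sigma}\left(\frac{D_\sigma u}{d_\sigma}\right)^p,$$ where $D_\sigma u=|u_K-u_L|$ and $d_\sigma=d_{K,\sigma}+d_{L,\sigma}$ if $\mathcal M_\sigma=\{K,L\}$ with $K\neq L$, and $D_\sigma u=|u_K|$ and $d_\sigma=d_{K,\sigma}$ if $\mathcal M_\sigma=\{K\}$. -/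

import Mathlib

open MeasureTheory
open scoped ENNReal

/-- The hyperplanes of `ℝ^d`. -/
def IsHyperplane {d : ℕ} (H : Set (EuclideanSpace ℝ (Fin d))) : Prop :=
  ∃ (n : EuclideanSpace ℝ (Fin d)) (c : ℝ), n ≠ 0 ∧ H = {x | inner ℝ n x = c}

/-- A set is polyhedral if its boundary is a finite union of subsets of hyperplanes. -/
def HasPolyhedralBoundary {d : ℕ} (A : Set (EuclideanSpace ℝ (Fin d))) : Prop :=
  ∃ 𝓗 : Set (Set (EuclideanSpace ℝ (Fin d))),
    𝓗.Finite ∧ (∀ H ∈ 𝓗, IsHyperplane H) ∧ frontier A ⊆ ⋃₀ 𝓗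

open Classical in
/-- A discretisation `(M, E, P)` of a set `Ω` of `ℝ^d` (which is meant to be open, bounded,
connected and polyhedral). The maps `edgesOf` and `center` matter only on `cells`. -/
structure Discretisation {d : ℕ} (Ω : Set (EuclideanSpace ℝ (Fin d))) where
  /-- the finite family `M` of control volumes -/
  cells : Finset (Set (EuclideanSpace ℝ (Fin d)))
  /-- the finite family `E` of edges -/
  edges : Finset (Set (EuclideanSpace ℝ (Fin d)))
  /-- the set `E_K` of the edges of the control volume `K` -/
  edgesOf : Set (EuclideanSpace ℝ (Fin d)) → Finset (Set (EuclideanSpace ℝ (Fin d)))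
  /-- the point `x_K` of the control volume `K` -/
  center : Set (EuclideanSpace ℝ (Fin d)) → EuclideanSpace ℝ (Fin d)
  cell_isOpen : ∀ K ∈ cells, IsOpen K
  cell_isConnected : ∀ K ∈ cells, IsConnected K
  cell_subset : ∀ K ∈ cells, K ⊆ Ω
  cell_disjoint : ∀ K ∈ cells, ∀ L ∈ cells, K ≠ L → Disjoint K L
  closure_eq : closure Ω = ⋃ K ∈ cells, closure K
  edge_nonempty : ∀ σ ∈ edges, σ.Nonempty
  edge_subset : ∀ σ ∈ edges, σ ⊆ closure Ω
  edge_disjoint : ∀ σ ∈ edges, ∀ τ ∈ edges, σ ≠ τ → Disjoint σ τ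
  /-- each edge is a (relatively) open subset of a hyperplane -/
  edge_open : ∀ σ ∈ edges, ∃ H U : Set (EuclideanSpace ℝ (Fin d)),
    IsHyperplane H ∧ IsOpen U ∧ σ = U ∩ H
  /-- the `(d-1)`-dimensional measure of an edge is positive -/
  edge_measure_pos : ∀ σ ∈ edges, 0 < Measure.euclideanHausdorffMeasure (d - 1) σ
  /-- the relative boundary of an edge is `(d-1)`-negligible -/
  edge_boundary_null : ∀ σ ∈ edges,
    Measure.euclideanHausdorffMeasure (d - 1) (closure σ \ σ) = 0
  edgesOf_subset : ∀ K ∈ cells, edgesOf K ⊆ edges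
  frontier_cell : ∀ K ∈ cells, frontier K = ⋃ σ ∈ edgesOf K, closure σ
  /-- an edge belongs either to exactly one control volume, and then it lies on the boundary of
  `Ω`, or to exactly two control volumes -/
  edge_cells : ∀ σ ∈ edges,
    ((cells.filter fun K => σ ∈ edgesOf K).card = 1 ∧ σ ⊆ frontier Ω) ∨
      (cells.filter fun K => σ ∈ edgesOf K).card = 2
  center_mem : ∀ K ∈ cells, center K ∈ K
  cell_starShaped : ∀ K ∈ cells, StarConvex ℝ (center K) K
  /-- the distance from `x_K` to the hyperplane that includes `σ` is positive -/
  dist_pos : ∀ K ∈ cells, ∀ σ ∈ edgesOf K,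
    0 < Metric.infDist (center K) (affineSpan ℝ σ : Set (EuclideanSpace ℝ (Fin d)))

namespace Discretisation

variable {d : ℕ} {Ω : Set (EuclideanSpace ℝ (Fin d))}

open Classical in
/-- The set `M_σ` of the control volumes that have `σ` among their edges. -/
noncomputable def cellsOf (D : Discretisation Ω) (σ : Set (EuclideanSpace ℝ (Fin d))) :
    Finset (Set (EuclideanSpace ℝ (Fin d))) :=
  D.cells.filter fun K => σ ∈ D.edgesOf K

/-- The distance `d_{K,σ}` from `x_K` to the hyperplane that includes `σ`; this hyperplane is the
affine span of `σ`, because `σ` is a nonempty relatively open subset of it. -/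
noncomputable def cellDist (D : Discretisation Ω) (K σ : Set (EuclideanSpace ℝ (Fin d))) : ℝ :=
  Metric.infDist (D.center K) (affineSpan ℝ σ : Set (EuclideanSpace ℝ (Fin d)))

/-- `d_σ`, equal to `d_{K,σ} + d_{L,σ}` if `M_σ = {K, L}` and to `d_{K,σ}` if `M_σ = {K}`. -/
noncomputable def edgeDist (D : Discretisation Ω) (σ : Set (EuclideanSpace ℝ (Fin d))) : ℝ :=
  ∑ K ∈ D.cellsOf σ, D.cellDist K σ

open Classical in
/-- For `K ∈ M_σ`, the jump `D_σ u` of the family `(u_K)` of cell values across `σ`: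
it is `|u_K - u_L|` if `M_σ = {K, L}`, and `|u_K|` if `M_σ = {K}` (the sum is empty then). -/
noncomputable def jump (D : Discretisation Ω) (v : Set (EuclideanSpace ℝ (Fin d)) → ℝ)
    (K σ : Set (EuclideanSpace ℝ (Fin d))) : ℝ :=
  |v K - ∑ L ∈ (D.cellsOf σ).erase K, v L|

theorem jump_of_cellsOf_eq_singleton (D : Discretisation Ω)
    (v : Set (EuclideanSpace ℝ (Fin d)) → ℝ) {K σ : Set (EuclideanSpace ℝ (Fin d))}
    (h : D.cellsOf σ = {K}) : D.jump v K σ = |v K| := by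
  classical
  simp [jump, h]

open Classical in
theorem jump_of_cellsOf_eq_pair (D : Discretisation Ω)
    (v : Set (EuclideanSpace ℝ (Fin d)) → ℝ) {K L σ : Set (EuclideanSpace ℝ (Fin d))}
    (hKL : K ≠ L) (h : D.cellsOf σ = {K, L}) :
    D.jump v K σ = |v K - v L| ∧ D.jump v L σ = |v K - v L| := by
  have h1 : ({K, L} : Finset (Set (EuclideanSpace ℝ (Fin d)))).erase K = {L} :=
    Finset.erase_insert (by simpa using hKL)
  have h2 : ({K, L} : Finset (Set (EuclideanSpace ℝ (Fin d)))).erase L = {K} := by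
    rw [Finset.pair_comm]
    exact Finset.erase_insert (by simpa using hKL.symm)
  constructor
  · rw [jump, h, h1, Finset.sum_singleton]
  · rw [jump, h, h2, Finset.sum_singleton, abs_sub_comm]

/-- The discrete `W^{1,p}` norm of the piecewise constant function with cell values `(u_K)`. -/
noncomputable def discreteNorm (D : Discretisation Ω) (p : ℝ)
    (v : Set (EuclideanSpace ℝ (Fin d)) → ℝ) : ℝ :=
  (∑ K ∈ D.cells, ∑ σ ∈ D.edgesOf K,
    (Measure.euclideanHausdorffMeasure (d - 1)).real σ * D.cellDist K σ *
      (D.jump v K σ / D.edgeDist σ) ^ p) ^ (1 / p)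

/-- `u` is piecewise constant on the mesh, with the value `v K` (almost everywhere) on each control
volume `K`. -/
def HasCellValues (D : Discretisation Ω) (u : EuclideanSpace ℝ (Fin d) → ℝ)
    (v : Set (EuclideanSpace ℝ (Fin d)) → ℝ) : Prop :=
  ∀ K ∈ D.cells, ∀ᵐ x ∂(volume.restrict K), u x = v K

/-- `η ≤ d_{K,σ} / d_{L,σ} ≤ 1 / η` for all edges `σ` with `M_σ = {K, L}`. -/
def IsRegular (D : Discretisation Ω) (η : ℝ) : Prop :=
  ∀ σ ∈ D.edges, ∀ K ∈ D.cellsOf σ, ∀ L ∈ D.cellsOf σ, K ≠ L →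
    η ≤ D.cellDist K σ / D.cellDist L σ ∧ D.cellDist K σ / D.cellDist L σ ≤ 1 / η

end Discretisation

/-! The inequality is reduced to its case `p = 1`, which is proved as Gagliardo and Nirenberg do it.
On almost every line parallel to a coordinate axis, the function with cell values `w` starts from
`0` outside the bounded set `Ω` and changes only across edges, so `|w|` at a point is at most the
sum of the jumps along the line (`IsFrame.abs_cellFunction_le`). For each axis this bound depends
only on the projection of the point along that axis. Multiplying the bounds for the `d` axes and
applying a Loomis–Whitney inequality gives `‖w‖_{d/(d-1)} ≤ d ∑ |σ| D_σ w`, with each edge counted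
once per adjacent cell, because projections do not increase `|σ|`
(`lintegral_cellFunction_rpow_le`).

For `p > 1` this is applied to `w = |v|^γ` with `γ = p(d-1)/(d-p)`. The jumps of `|v|^γ` are
controlled by `|v_K|^(γ-1) D_σ v`. Regularity gives `d_σ ≤ (1 + 1/η) d_{K,σ}`, so Hölder's
inequality with the weights `|σ| d_{K,σ}` brings out the discrete norm and a power of `∑_K (∑_σ |σ|
d_{K,σ}) |v_K|^q`, where `q = pd/(d-p)` (`sum_measure_mul_jump_le`). The inner sum is at most `2^d
|K|`, since the cones from `x_K` over the edges of `K` are disjoint subsets of `K`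
(`sum_edge_measure_mul_cellDist_le`). Dividing by the power of `∑ |K| |v_K|^q` on the right leaves
the exponent `1/q` on the left. -/

/-! ### Hyperplanes and cones over their open subsets. -/

section HyperplaneGeometry

open Set Filter Topology

variable {E : Type*} [NormedAddCommGroup E] [InnerProductSpace ℝ E]

/-- A hyperplane is the affine span of each of its nonempty relatively open subsets. -/
theorem hyperplane_subset_affineSpan {n : E} {c : ℝ} {U : Set E} (hU : IsOpen U)
    (hne : (U ∩ {x | inner ℝ n x = c}).Nonempty) :
    {x | inner ℝ n x = c} ⊆ (affineSpan ℝ (U ∩ {x | inner ℝ n x = c}) : Set E) := by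
  obtain ⟨y, hyU, hy⟩ := hne
  intro h hh
  simp only [mem_ofPred_eq] at hy hh
  have hev : ∀ᶠ t : ℝ in 𝓝[>] 0, y + t • (h - y) ∈ U := by
    have hc : ContinuousAt (fun t : ℝ => y + t • (h - y)) 0 := by fun_prop
    have : ∀ᶠ t : ℝ in 𝓝 0, y + t • (h - y) ∈ U :=
      hc.eventually_mem (hU.mem_nhds (by simpa using hyU))
    exact this.filter_mono nhdsWithin_le_nhds
  obtain ⟨t, htU, ht⟩ := (hev.and self_mem_nhdsWithin).exists
  have ht0 : (t : ℝ) ≠ 0 := (show (0 : ℝ) < t from ht).ne'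
  have hyS : y ∈ affineSpan ℝ (U ∩ {x | inner ℝ n x = c}) :=
    subset_affineSpan ℝ _ ⟨hyU, hy⟩
  have hzS : y + t • (h - y) ∈ affineSpan ℝ (U ∩ {x | inner ℝ n x = c}) := by
    refine subset_affineSpan ℝ _ ⟨htU, ?_⟩
    simp [inner_add_right, inner_smul_right, inner_sub_right, hy, hh]
  have := AffineMap.lineMap_mem (Q := affineSpan ℝ (U ∩ {x | inner ℝ n x = c})) t⁻¹ hyS hzS
  simpa [AffineMap.lineMap_apply, smul_smul, ht0] using this

theorem infDist_mul_norm_le {n : E} {c : ℝ} (hn : n ≠ 0) {S : Set E}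
    (hS : {x | inner ℝ n x = c} ⊆ S) (x : E) :
    Metric.infDist x S * ‖n‖ ≤ |c - inner ℝ n x| := by
  have hn' : ‖n‖ ≠ 0 := norm_ne_zero_iff.2 hn
  -- This point is the foot of the perpendicular from `x` to the hyperplane.
  have hmem : x + ((c - inner ℝ n x) / ‖n‖ ^ 2) • n ∈ S := by
    apply hS
    simp only [mem_ofPred_eq, inner_add_right, inner_smul_right, real_inner_self_eq_norm_sq]
    field_simp
    ring
  have h := Metric.infDist_le_dist_of_mem (x := x) hmem
  rw [dist_self_add_right, norm_smul, Real.norm_eq_abs, abs_div, abs_of_nonneg (sq_nonneg ‖n‖)] at h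
  calc Metric.infDist x S * ‖n‖ ≤ |c - inner ℝ n x| / ‖n‖ ^ 2 * ‖n‖ * ‖n‖ := by gcongr
    _ = |c - inner ℝ n x| := by field_simp

/-- If the boundary of an open set that is star-shaped with respect to `x` lies in finitely many
hyperplanes that avoid `x`, then each ray from `x` meets this boundary at most once. -/
theorem StarConvex.add_smul_sub_mem_of_mem_closure {K : Set E} (hK : IsOpen K) {x : E}
    (hxK : x ∈ K) (hs : StarConvex ℝ x K) {ι : Type*} {I : Set ι} (hI : I.Finite) {n : ι → E}
    {c : ι → ℝ} (hx : ∀ i ∈ I, inner ℝ (n i) x ≠ c i)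
    (hfr : frontier K ⊆ ⋃ i ∈ I, {z | inner ℝ (n i) z = c i}) {y : E} (hy : y ∈ closure K)
    {s : ℝ} (hs0 : 0 ≤ s) (hs1 : s < 1) : x + s • (y - x) ∈ K := by
  -- If this point were missing from `K`, so would be every later point of the segment to `y`. A
  -- nondegenerate segment would then lie in the frontier, whereas each hyperplane, avoiding `x`,
  -- meets the ray at most once.
  by_contra hcon
  have hnot : ∀ r ∈ Icc s 1, x + r • (y - x) ∉ K := by
    intro r hr hmem
    apply hcon
    rcases hs0.eq_or_lt with h0 | h0
    · simpa [← h0] using hxK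
    · have hr0 : 0 < r := h0.trans_le hr.1
      have := hs.add_smul_sub_mem hmem (div_nonneg hs0 hr0.le) ((div_le_one hr0).2 hr.1)
      rwa [add_sub_cancel_left, smul_smul, div_mul_cancel₀ _ hr0.ne'] at this
  have hcl : ∀ r ∈ Icc s 1, x + r • (y - x) ∈ closure K := by
    intro r hr
    refine map_mem_closure (f := fun y => x + r • (y - x)) (by fun_prop) hy fun z hz => ?_
    exact hs.add_smul_sub_mem hz (hs0.trans hr.1) hr.2
  have hsub : Icc s 1 ⊆ ⋃ i ∈ I, {r : ℝ | inner ℝ (n i) (x + r • (y - x)) = c i} := by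
    intro r hr
    have : x + r • (y - x) ∈ frontier K := by
      rw [frontier, hK.interior_eq]
      exact ⟨hcl r hr, hnot r hr⟩
    simpa using hfr this
  refine (Set.Icc_infinite hs1) ((hI.biUnion fun i hi => ?_).subset hsub)
  refine Set.Subsingleton.finite fun r hr r' hr' => ?_
  simp only [mem_ofPred_eq, inner_add_right, inner_smul_right] at hr hr'
  have hne : inner ℝ (n i) (y - x) ≠ 0 := by
    intro h0
    exact hx i hi (by simpa [h0] using hr)
  exact mul_right_cancel₀ hne (by linarith)

/-- The open cone with apex `x` over the set `σ`. -/
def openCone (x : E) (σ : Set E) : Set E :=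
  {z | ∃ s ∈ Ioo (0 : ℝ) 1, ∃ y ∈ σ, z = x + s • (y - x)}

/-- The affine function `(⟪n, z⟫ - ⟪n, x⟫) / (c - ⟪n, x⟫)` recovers the parameter `s` from `z`. This
removes the existential quantifiers and makes measurability and local behaviour of the cone
accessible. -/
theorem mem_openCone_hyperplane {x n : E} {c : ℝ} (hx : inner ℝ n x ≠ c) {U : Set E} {z : E} :
    z ∈ openCone x (U ∩ {y | inner ℝ n y = c}) ↔
      (inner ℝ n z - inner ℝ n x) / (c - inner ℝ n x) ∈ Ioo (0 : ℝ) 1 ∧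
        x + ((inner ℝ n z - inner ℝ n x) / (c - inner ℝ n x))⁻¹ • (z - x) ∈ U := by
  have hx' : c - inner ℝ n x ≠ 0 := sub_ne_zero.2 hx.symm
  constructor
  · rintro ⟨s, hs, y, ⟨hyU, hy⟩, rfl⟩
    simp only [mem_ofPred_eq] at hy
    have : (inner ℝ n (x + s • (y - x)) - inner ℝ n x) / (c - inner ℝ n x) = s := by
      rw [inner_add_right, inner_smul_right, inner_sub_right, hy]
      field_simp
      ring
    rw [this]
    refine ⟨hs, ?_⟩
    rwa [add_sub_cancel_left, smul_smul, inv_mul_cancel₀ hs.1.ne', one_smul, add_sub_cancel]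
  · rintro ⟨hs, hU⟩
    refine ⟨_, hs, _, ⟨hU, ?_⟩, ?_⟩
    · have h0 := hs.1.ne'
      simp only [mem_ofPred_eq, inner_add_right, inner_smul_right, inner_sub_right]
      have h1 : inner ℝ n z - inner ℝ n x ≠ 0 := by
        intro h
        simp [h] at h0
      field_simp
      ring
    · rw [add_sub_cancel_left, smul_smul, mul_inv_cancel₀ hs.1.ne', one_smul, add_sub_cancel]

theorem measurableSet_openCone [MeasurableSpace E] [BorelSpace E] [SecondCountableTopology E]
    {x n : E} {c : ℝ} (hx : inner ℝ n x ≠ c) {U : Set E}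
    (hU : IsOpen U) : MeasurableSet (openCone x (U ∩ {y | inner ℝ n y = c})) := by
  have h : Measurable fun z : E => (inner ℝ n z - inner ℝ n x) / (c - inner ℝ n x) := by fun_prop
  have h2 : Measurable fun z : E =>
      x + ((inner ℝ n z - inner ℝ n x) / (c - inner ℝ n x))⁻¹ • (z - x) := by fun_prop
  have : openCone x (U ∩ {y | inner ℝ n y = c}) =
      {z | (inner ℝ n z - inner ℝ n x) / (c - inner ℝ n x) ∈ Ioo (0 : ℝ) 1} ∩
        {z | x + ((inner ℝ n z - inner ℝ n x) / (c - inner ℝ n x))⁻¹ • (z - x) ∈ U} := by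
    ext z
    exact mem_openCone_hyperplane hx
  rw [this]
  exact (h measurableSet_Ioo).inter (h2 hU.measurableSet)

/-- Near a point of a relatively open subset of a hyperplane, the cone over this subset covers the
side of its apex. -/
theorem eventually_mem_openCone {x n : E} {c : ℝ} (hx : inner ℝ n x ≠ c) {U : Set E}
    (hU : IsOpen U) {y : E} (hy : y ∈ U ∩ {y | inner ℝ n y = c}) :
    ∀ᶠ z in 𝓝 y, 0 < (inner ℝ n z - c) * (inner ℝ n x - c) →
      z ∈ openCone x (U ∩ {y | inner ℝ n y = c}) := by
  have hx' : c - inner ℝ n x ≠ 0 := sub_ne_zero.2 hx.symm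
  have hyc : inner ℝ n y = c := hy.2
  have hρ : ContinuousAt (fun z : E => (inner ℝ n z - inner ℝ n x) / (c - inner ℝ n x)) y := by
    fun_prop
  have hρy : (inner ℝ n y - inner ℝ n x) / (c - inner ℝ n x) = 1 := by rw [hyc, div_self hx']
  have h1 : ∀ᶠ z in 𝓝 y, (inner ℝ n z - inner ℝ n x) / (c - inner ℝ n x) ∈ Ioi (0 : ℝ) :=
    hρ.eventually_mem (isOpen_Ioi.mem_nhds (by simp [hρy]))
  have h2 : ∀ᶠ z in 𝓝 y,
      x + ((inner ℝ n z - inner ℝ n x) / (c - inner ℝ n x))⁻¹ • (z - x) ∈ U := by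
    refine ContinuousAt.eventually_mem (f := fun z =>
      x + ((inner ℝ n z - inner ℝ n x) / (c - inner ℝ n x))⁻¹ • (z - x)) ?_ ?_
    · have := hρ.inv₀ (by simp [hρy])
      exact continuousAt_const.add (this.smul (by fun_prop))
    · simp only [hρy]
      exact hU.mem_nhds (by simpa using hy.1)
  filter_upwards [h1, h2] with z hz1 hz2 hside
  refine (mem_openCone_hyperplane hx).2 ⟨⟨hz1, ?_⟩, hz2⟩
  -- The parameter of `z` is below `1` exactly when `z` and the apex are on the same side.
  have : 1 - (inner ℝ n z - inner ℝ n x) / (c - inner ℝ n x) =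
      (inner ℝ n z - c) * (inner ℝ n x - c) / (c - inner ℝ n x) ^ 2 := by
    field_simp
    ring
  have : 0 < 1 - (inner ℝ n z - inner ℝ n x) / (c - inner ℝ n x) := by
    rw [this]
    positivity
  linarith

end HyperplaneGeometry

/-! ### Volume of a cone by slicing. -/

/-- The volume of the cone with apex `x` over a relatively open subset `σ` of a hyperplane bounds
the measure of `σ` times its distance from `x`. -/
theorem measure_mul_infDist_le_volume_openCone {m : ℕ} {x n : EuclideanSpace ℝ (Fin (m + 1))}
    {c : ℝ} (hn : n ≠ 0) (hx : inner ℝ n x ≠ c) {U : Set (EuclideanSpace ℝ (Fin (m + 1)))}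
    (hU : IsOpen U) :
    Measure.euclideanHausdorffMeasure m (U ∩ {y | inner ℝ n y = c}) *
        ENNReal.ofReal (|c - inner ℝ n x| / ‖n‖) ≤
      2 ^ (m + 1) * volume (openCone x (U ∩ {y | inner ℝ n y = c})) := by
  set σ := U ∩ {y | inner ℝ n y = c} with hσ
  have hn' : ‖n‖ ≠ 0 := norm_ne_zero_iff.2 hn
  have hx' : c - inner ℝ n x ≠ 0 := sub_ne_zero.2 hx.symm
  -- `v` leads from `x` to its orthogonal projection on the hyperplane; the slices are orthogonal to
  -- it.
  set v : EuclideanSpace ℝ (Fin (m + 1)) := ((c - inner ℝ n x) / ‖n‖ ^ 2) • n with hv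
  have hv0 : v ≠ 0 := smul_ne_zero (div_ne_zero hx' (pow_ne_zero _ hn')) hn
  have hvn : ‖v‖ = |c - inner ℝ n x| / ‖n‖ := by
    rw [hv, norm_smul, Real.norm_eq_abs, abs_div, abs_of_nonneg (sq_nonneg ‖n‖)]
    field_simp
  have key := EuclideanGeometry.euclideanHausdorffMeasure_eq_lintegral x hv0
    (measurableSet_openCone hx hU)
  rw [InnerProductSpace.euclideanHausdorffMeasure_eq_volume, finrank_euclideanSpace_fin,
    Nat.add_sub_cancel] at key
  -- The slice at height `r` contains the homothetic copy of `σ` with ratio `r`. Keeping only `r >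
  -- 1/2` loses a constant but avoids integrating `r ^ m`: the factor `2 ^ (m + 1)` comes from `2 ^
  -- m` for the slices and `2` for the length of the interval.
  have hslice : ∀ r ∈ Set.Ioo (2⁻¹ : ℝ) 1,
      (2⁻¹ : ℝ≥0∞) ^ m * Measure.euclideanHausdorffMeasure m σ ≤
        Measure.euclideanHausdorffMeasure m
          (openCone x σ ∩ AffineSubspace.mk' (r • v +ᵥ x) (ℝ ∙ v)ᗮ) := by
    intro r hr
    have hr0 : 0 < r := lt_trans (by norm_num) hr.1
    calc (2⁻¹ : ℝ≥0∞) ^ m * Measure.euclideanHausdorffMeasure m σ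
        ≤ (‖r‖₊ : ℝ≥0∞) ^ m * Measure.euclideanHausdorffMeasure m σ := by
          gcongr
          rw [← enorm_eq_nnnorm, Real.enorm_eq_ofReal hr0.le]
          rw [← ENNReal.ofReal_ofNat, ← ENNReal.ofReal_inv_of_pos (by norm_num)]
          exact ENNReal.ofReal_le_ofReal hr.1.le
      _ = Measure.euclideanHausdorffMeasure m (AffineMap.homothety x r '' σ) := by
          rw [euclideanHausdorffMeasure_homothety_image m x hr0.ne', ENNReal.smul_def, smul_eq_mul]
          simp
      _ ≤ _ := by
          refine measure_mono ?_
          rintro _ ⟨y, hy, rfl⟩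
          refine ⟨⟨r, ⟨hr0, hr.2⟩, y, hy, ?_⟩, ?_⟩
          · simp [AffineMap.homothety_apply, add_comm]
          · have hyc : inner ℝ n y = c := hy.2
            rw [SetLike.mem_coe, AffineSubspace.mem_mk', Submodule.mem_orthogonal_singleton_iff_inner_right]
            simp only [AffineMap.homothety_apply, vsub_eq_sub, vadd_eq_add]
            rw [add_sub_add_right_eq_sub, ← smul_sub, inner_smul_right, inner_sub_right,
              real_inner_self_eq_norm_sq, hvn, inner_sub_right, hv, inner_smul_left,
              inner_smul_left, hyc]
            simp only [map_div₀, conj_trivial, div_pow, sq_abs]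
            field_simp
            simp
  have hint : 2⁻¹ * ((2⁻¹ : ℝ≥0∞) ^ m * Measure.euclideanHausdorffMeasure m σ) ≤
      ∫⁻ r : ℝ, Measure.euclideanHausdorffMeasure m
          (openCone x σ ∩ AffineSubspace.mk' (r • v +ᵥ x) (ℝ ∙ v)ᗮ) := by
    calc 2⁻¹ * ((2⁻¹ : ℝ≥0∞) ^ m * Measure.euclideanHausdorffMeasure m σ)
        = ∫⁻ r in Set.Ioo (2⁻¹ : ℝ) 1,
            (2⁻¹ : ℝ≥0∞) ^ m * Measure.euclideanHausdorffMeasure m σ := by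
          rw [setLIntegral_const, Real.volume_Ioo, mul_comm]
          congr 1
          rw [← ENNReal.ofReal_ofNat, ← ENNReal.ofReal_inv_of_pos (by norm_num)]
          norm_num
      _ ≤ ∫⁻ r in Set.Ioo (2⁻¹ : ℝ) 1, Measure.euclideanHausdorffMeasure m
          (openCone x σ ∩ AffineSubspace.mk' (r • v +ᵥ x) (ℝ ∙ v)ᗮ) :=
          setLIntegral_mono' measurableSet_Ioo hslice
      _ ≤ _ := setLIntegral_le_lintegral _ _
  rw [key, ← hvn, ofReal_norm]
  calc Measure.euclideanHausdorffMeasure m σ * ‖v‖ₑ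
      = 2 ^ (m + 1) * (‖v‖ₑ * (2⁻¹ * ((2⁻¹ : ℝ≥0∞) ^ m * Measure.euclideanHausdorffMeasure m σ))) := by
        rw [← mul_assoc 2⁻¹, ← pow_succ', mul_left_comm, ← mul_assoc (2 ^ (m + 1)), ← mul_pow,
          ENNReal.mul_inv_cancel (by norm_num) (by norm_num), one_pow, one_mul, mul_comm]
    _ ≤ _ := by gcongr

/-! ### Piecewise constant functions of one variable. -/

section Jumps

open Set Filter Topology

/-- A function of a real variable that is locally constant outside finitely many points varies by
at most the sum of its jumps. -/
theorem abs_sub_le_sum_of_jumps {ι : Type*} (S : Finset ι) {τ j : ι → ℝ} {g : ℝ → ℝ}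
    (hj : ∀ i ∈ S, 0 ≤ j i) {a b : ℝ} (hab : a ≤ b) (hτ : ∀ i ∈ S, τ i ∈ Ioo a b)
    (hg : ∀ t ∈ Icc a b, (∀ i ∈ S, τ i ≠ t) → ∀ᶠ s in 𝓝 t, g s = g t)
    (hjump : ∀ i ∈ S, ∃ V ∈ 𝓝 (τ i), ∀ s ∈ V, ∀ s' ∈ V, s ≠ τ i → s' ≠ τ i → |g s - g s'| ≤ j i) :
    |g b - g a| ≤ ∑ i ∈ S, j i := by
  classical
  induction S using Finset.strongInduction generalizing a b with
  | H S ih =>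
  rcases S.eq_empty_or_nonempty with rfl | ⟨i, hi⟩
  · have hd : ∀ t ∈ Icc a b, HasDerivWithinAt g 0 (Icc a b) t := by
      intro t ht
      exact ((hasDerivAt_const t (g t)).congr_of_eventuallyEq (hg t ht (by simp))).hasDerivWithinAt
    have := (convex_Icc a b).norm_image_sub_le_of_norm_hasDerivWithin_le (C := 0) hd (by simp)
      (left_mem_Icc.2 hab) (right_mem_Icc.2 hab)
    simpa using this
  -- One jump point is isolated in a short interval whose ends are no jump points; induction handles
  -- the two sides.
  · obtain ⟨V, hV, hVj⟩ := hjump i hi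
    have hfin : ((S.image τ : Set ℝ) \ {τ i})ᶜ ∈ 𝓝 (τ i) :=
      ((S.image τ).finite_toSet.subset sdiff_subset).isClosed.isOpen_compl.mem_nhds (by simp)
    obtain ⟨ε, hε, hball⟩ := Metric.mem_nhds_iff.1
      (inter_mem (inter_mem hV (isOpen_Ioo.mem_nhds (hτ i hi))) hfin)
    have hs : τ i - ε / 2 ∈ Metric.ball (τ i) ε := by
      simp [abs_of_pos hε, hε]
    have hs' : τ i + ε / 2 ∈ Metric.ball (τ i) ε := by
      simp [abs_of_pos hε, hε]
    obtain ⟨⟨hsV, hsab⟩, hsτ⟩ := hball hs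
    obtain ⟨⟨hsV', hsab'⟩, hsτ'⟩ := hball hs'
    set s := τ i - ε / 2 with hsdef
    set s' := τ i + ε / 2 with hsdef'
    have hlt : s < τ i := by linarith
    have hlt' : τ i < s' := by linarith
    have hne : ∀ k ∈ S, τ k ≠ s := by
      rintro k hk h
      exact hsτ ⟨by simpa using ⟨k, hk, h⟩, hlt.ne⟩
    have hne' : ∀ k ∈ S, τ k ≠ s' := by
      rintro k hk h
      exact hsτ' ⟨by simpa using ⟨k, hk, h⟩, hlt'.ne'⟩
    -- Since `τ` need not be injective, other indices may have the same jump point as `i`. They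
    -- belong to neither set, and `hsum` drops their nonnegative jumps.
    set S1 := S.filter fun k => τ k < s with hS1
    set S2 := S.filter fun k => s' < τ k with hS2
    have hi1 : i ∉ S1 := by simp [hS1, hlt.le]
    have hi2 : i ∉ S2 := by simp [hS2, hlt'.le]
    have hsub1 : S1 ⊂ S := (Finset.filter_subset _ _).ssubset_of_mem_notMem hi hi1
    have hsub2 : S2 ⊂ S := (Finset.filter_subset _ _).ssubset_of_mem_notMem hi hi2
    have h1 : |g s - g a| ≤ ∑ k ∈ S1, j k := by
      refine ih S1 hsub1 (fun k hk => hj k (hsub1.1 hk)) hsab.1.le ?_ ?_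
        (fun k hk => hjump k (hsub1.1 hk))
      · intro k hk
        exact ⟨(hτ k (hsub1.1 hk)).1, (Finset.mem_filter.1 hk).2⟩
      · intro t ht hk
        refine hg t ⟨ht.1, ht.2.trans hsab.2.le⟩ fun k hkS h => ?_
        exact hk k (Finset.mem_filter.2 ⟨hkS, (h.trans_le ht.2).lt_of_ne (hne k hkS)⟩) h
    have h2 : |g b - g s'| ≤ ∑ k ∈ S2, j k := by
      refine ih S2 hsub2 (fun k hk => hj k (hsub2.1 hk)) hsab'.2.le ?_ ?_
        (fun k hk => hjump k (hsub2.1 hk))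
      · intro k hk
        exact ⟨(Finset.mem_filter.1 hk).2, (hτ k (hsub2.1 hk)).2⟩
      · intro t ht hk
        refine hg t ⟨hsab'.1.le.trans ht.1, ht.2⟩ fun k hkS h => ?_
        exact hk k (Finset.mem_filter.2 ⟨hkS, (ht.1.trans h.ge).lt_of_ne (hne' k hkS).symm⟩) h
    have h3 : |g s' - g s| ≤ j i := hVj _ hsV' _ hsV hlt'.ne' hlt.ne
    have hdisj : Disjoint S1 S2 := by
      rw [Finset.disjoint_left]
      intro k hk1 hk2
      have := (Finset.mem_filter.1 hk1).2
      have := (Finset.mem_filter.1 hk2).2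
      linarith
    have hsum : j i + (∑ k ∈ S1, j k + ∑ k ∈ S2, j k) ≤ ∑ k ∈ S, j k := by
      rw [← Finset.sum_union hdisj, ← Finset.sum_insert (by simp [hi1, hi2])]
      refine Finset.sum_le_sum_of_subset_of_nonneg ?_ fun k hk _ => hj k hk
      exact Finset.insert_subset hi (Finset.union_subset hsub1.1 hsub2.1)
    have htri : |g b - g a| ≤ |g b - g s'| + |g s' - g s| + |g s - g a| := by
      have h4 := abs_sub_le (g b) (g s') (g a)
      have h5 := abs_sub_le (g s') (g s) (g a)
      linarith
    linarith

end Jumps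

/-! ### Cells, edges, and jumps along a line. -/

namespace Discretisation

open Set Filter Topology

variable {d : ℕ} {Ω : Set (EuclideanSpace ℝ (Fin d))}

/-- The vectors `n σ`, the reals `c σ` and the open sets `U σ` describe the edges `σ` as
`U σ ∩ {x | ⟪n σ, x⟫ = c σ}`. -/
def IsFrame (D : Discretisation Ω) (n : Set (EuclideanSpace ℝ (Fin d)) → EuclideanSpace ℝ (Fin d))
    (c : Set (EuclideanSpace ℝ (Fin d)) → ℝ)
    (U : Set (EuclideanSpace ℝ (Fin d)) → Set (EuclideanSpace ℝ (Fin d))) : Prop :=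
  ∀ σ ∈ D.edges, n σ ≠ 0 ∧ IsOpen (U σ) ∧ σ = U σ ∩ {x | inner ℝ (n σ) x = c σ}

theorem exists_isFrame (D : Discretisation Ω) : ∃ n c U, D.IsFrame n c U := by
  have h : ∀ σ : Set (EuclideanSpace ℝ (Fin d)), ∃ (n : EuclideanSpace ℝ (Fin d)) (c : ℝ)
      (U : Set (EuclideanSpace ℝ (Fin d))), σ ∈ D.edges →
        n ≠ 0 ∧ IsOpen U ∧ σ = U ∩ {x | inner ℝ n x = c} := by
    intro σ
    by_cases hσ : σ ∈ D.edges
    · obtain ⟨_, U, ⟨n, c, hn, rfl⟩, hU, h⟩ := D.edge_open σ hσ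
      exact ⟨n, c, U, fun _ => ⟨hn, hU, h⟩⟩
    · exact ⟨0, 0, ∅, fun h => absurd h hσ⟩
  choose n c U h using h
  exact ⟨n, c, U, h⟩

variable {D : Discretisation Ω} {n : Set (EuclideanSpace ℝ (Fin d)) → EuclideanSpace ℝ (Fin d)}
  {c : Set (EuclideanSpace ℝ (Fin d)) → ℝ}
  {U : Set (EuclideanSpace ℝ (Fin d)) → Set (EuclideanSpace ℝ (Fin d))}
  {K L σ τ : Set (EuclideanSpace ℝ (Fin d))} {x y : EuclideanSpace ℝ (Fin d)}

theorem mem_cellsOf : K ∈ D.cellsOf σ ↔ K ∈ D.cells ∧ σ ∈ D.edgesOf K := by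
  simp [cellsOf]

theorem cellsOf_eq (hσ : σ ∈ D.edges) :
    (∃ K, D.cellsOf σ = {K}) ∨ ∃ K L, K ≠ L ∧ D.cellsOf σ = {K, L} := by
  classical
  rcases D.edge_cells σ hσ with ⟨h, _⟩ | h
  · obtain ⟨K, hK⟩ := Finset.card_eq_one.1 h
    exact Or.inl ⟨K, hK⟩
  · obtain ⟨K, L, hKL, hK⟩ := Finset.card_eq_two.1 h
    exact Or.inr ⟨K, L, hKL, hK⟩

theorem cellsOf_nonempty (hσ : σ ∈ D.edges) : (D.cellsOf σ).Nonempty := by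
  rcases cellsOf_eq hσ with ⟨K, h⟩ | ⟨K, L, -, h⟩ <;> simp [h]

theorem edge_subset_frontier (hK : K ∈ D.cells) (hσ : σ ∈ D.edgesOf K) : σ ⊆ frontier K := by
  rw [D.frontier_cell K hK]
  exact subset_closure.trans (subset_biUnion_of_mem (u := closure) hσ)

theorem IsFrame.closure_subset (hF : D.IsFrame n c U) (hσ : σ ∈ D.edges) :
    closure σ ⊆ {x | inner ℝ (n σ) x = c σ} := by
  refine closure_minimal ?_ (isClosed_eq (by fun_prop) (by fun_prop))
  nth_rewrite 1 [(hF σ hσ).2.2]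
  exact inter_subset_right

theorem IsFrame.subset_affineSpan (hF : D.IsFrame n c U) (hσ : σ ∈ D.edges) :
    {x | inner ℝ (n σ) x = c σ} ⊆ (affineSpan ℝ σ : Set (EuclideanSpace ℝ (Fin d))) := by
  have h := (hF σ hσ).2.2
  have := hyperplane_subset_affineSpan (hF σ hσ).2.1 (n := n σ) (c := c σ)
    (h ▸ D.edge_nonempty σ hσ)
  rwa [← h] at this

theorem IsFrame.inner_center_ne (hF : D.IsFrame n c U) (hK : K ∈ D.cells) (hσ : σ ∈ D.edgesOf K) :
    inner ℝ (n σ) (D.center K) ≠ c σ := by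
  intro h
  have hmem := hF.subset_affineSpan (D.edgesOf_subset K hK hσ) h
  have := D.dist_pos K hK σ hσ
  rw [Metric.infDist_zero_of_mem hmem] at this
  exact lt_irrefl _ this

theorem IsFrame.cellDist_le (hF : D.IsFrame n c U) (hσ : σ ∈ D.edges) :
    D.cellDist K σ ≤ |c σ - inner ℝ (n σ) (D.center K)| / ‖n σ‖ := by
  rw [le_div_iff₀ (norm_pos_iff.2 (hF σ hσ).1)]
  exact infDist_mul_norm_le (hF σ hσ).1 (hF.subset_affineSpan hσ) _

theorem add_smul_sub_center_mem (hK : K ∈ D.cells) (hy : y ∈ closure K) {s : ℝ} (hs0 : 0 ≤ s)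
    (hs1 : s < 1) : D.center K + s • (y - D.center K) ∈ K := by
  obtain ⟨n, c, U, hF⟩ := D.exists_isFrame
  refine StarConvex.add_smul_sub_mem_of_mem_closure (D.cell_isOpen K hK) (D.center_mem K hK)
    (D.cell_starShaped K hK) (I := {σ | σ ∈ D.edgesOf K}) (Finset.finite_toSet _) (n := n) (c := c)
    (fun σ hσ => hF.inner_center_ne hK hσ) ?_ hy hs0 hs1
  rw [D.frontier_cell K hK]
  exact iUnion₂_mono fun σ hσ => hF.closure_subset (D.edgesOf_subset K hK hσ)

theorem openCone_subset (hK : K ∈ D.cells) (hσ : σ ∈ D.edgesOf K) :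
    openCone (D.center K) σ ⊆ K := by
  rintro _ ⟨s, hs, y, hy, rfl⟩
  exact add_smul_sub_center_mem hK (frontier_subset_closure (edge_subset_frontier hK hσ hy))
    hs.1.le hs.2

/-- A ray from `x_K` meets the frontier of `K` only once, so a common point of the two cones would
come from a common point of the two edges. -/
theorem disjoint_openCone (hK : K ∈ D.cells) (hσ : σ ∈ D.edgesOf K) (hτ : τ ∈ D.edgesOf K)
    (h : σ ≠ τ) : Disjoint (openCone (D.center K) σ) (openCone (D.center K) τ) := by
  have key : ∀ {y y' : EuclideanSpace ℝ (Fin d)} {s s' : ℝ}, y ∈ frontier K → y' ∈ frontier K →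
      0 < s → 0 < s' → D.center K + s • (y - D.center K) = D.center K + s' • (y' - D.center K) →
      s' ≤ s := by
    intro y y' s s' hy hy' hs hs' heq
    by_contra hlt
    push Not at hlt
    have h2 : y' = D.center K + (s / s') • (y - D.center K) := by
      have h3 := add_left_cancel heq
      rw [div_eq_inv_mul, mul_smul, h3, smul_smul, inv_mul_cancel₀ hs'.ne', one_smul,
        add_sub_cancel]
    have h4 : y' ∈ K := by
      rw [h2]
      exact add_smul_sub_center_mem hK (frontier_subset_closure hy) (by positivity)
        ((div_lt_one hs').2 hlt)
    rw [frontier, (D.cell_isOpen K hK).interior_eq] at hy'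
    exact hy'.2 h4
  rw [Set.disjoint_left]
  rintro z ⟨s, hs, y, hy, rfl⟩ ⟨s', hs', y', hy', heq⟩
  have hyf := edge_subset_frontier hK hσ hy
  have hyf' := edge_subset_frontier hK hτ hy'
  have hss : s = s' := le_antisymm (key hyf' hyf hs'.1 hs.1 heq.symm) (key hyf hyf' hs.1 hs'.1 heq)
  subst hss
  have hyy : y = y' := by
    have := smul_right_injective _ hs.1.ne' (add_left_cancel heq)
    exact sub_left_injective this
  subst hyy
  exact Set.disjoint_left.1 (D.edge_disjoint σ (D.edgesOf_subset K hK hσ) τ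
    (D.edgesOf_subset K hK hτ) h) hy hy'

/-- The set of the points that lie on the relative boundary of an edge. -/
def ridges (D : Discretisation Ω) : Set (EuclideanSpace ℝ (Fin d)) :=
  ⋃ σ ∈ D.edges, closure σ \ σ

theorem exists_mem_edge (hK : K ∈ D.cells) (hy : y ∈ frontier K) (hyr : y ∉ D.ridges) :
    ∃ σ ∈ D.edgesOf K, y ∈ σ := by
  rw [D.frontier_cell K hK] at hy
  obtain ⟨σ, hσ, hyσ⟩ := mem_iUnion₂.1 hy
  refine ⟨σ, hσ, ?_⟩
  by_contra h
  exact hyr (mem_iUnion₂.2 ⟨σ, D.edgesOf_subset K hK hσ, hyσ, h⟩)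

/-- If `y` were in the open set `L`, then `L` would meet a cell having `σ` as an edge. If `y` were
on the frontier of `L`, it would lie, off the ridges, in an edge of `L`, which is `σ` by
disjointness. -/
theorem notMem_closure_of_notMem_cellsOf (hσ : σ ∈ D.edges) (hy : y ∈ σ) (hyr : y ∉ D.ridges)
    (hL : L ∈ D.cells) (hLσ : L ∉ D.cellsOf σ) : y ∉ closure L := by
  intro hyL
  by_cases hmem : y ∈ L
  · obtain ⟨K, hKσ⟩ := cellsOf_nonempty hσ
    obtain ⟨hK, hσK⟩ := mem_cellsOf.1 hKσ
    obtain ⟨z, hzL, hzK⟩ := mem_closure_iff.1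
      (frontier_subset_closure (edge_subset_frontier hK hσK hy)) L (D.cell_isOpen L hL) hmem
    have hKL : K ≠ L := fun h => hLσ (h ▸ hKσ)
    exact Set.disjoint_left.1 (D.cell_disjoint K hK L hL hKL) hzK hzL
  · have hfr : y ∈ frontier L := by
      rw [frontier, (D.cell_isOpen L hL).interior_eq]
      exact ⟨hyL, hmem⟩
    obtain ⟨τ, hτ, hyτ⟩ := exists_mem_edge hL hfr hyr
    have : σ = τ := by
      by_contra hne
      exact Set.disjoint_left.1 (D.edge_disjoint σ hσ τ (D.edgesOf_subset L hL hτ) hne) hy hyτ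
    subst this
    exact hLσ (mem_cellsOf.2 ⟨hL, hτ⟩)

open Classical in
/-- The piecewise constant function with the value `w K` on the cell `K`, and `0` outside the
cells. -/
noncomputable def cellFunction (D : Discretisation Ω) (w : Set (EuclideanSpace ℝ (Fin d)) → ℝ)
    (x : EuclideanSpace ℝ (Fin d)) : ℝ :=
  ∑ K ∈ D.cells, K.indicator (fun _ => w K) x

variable {w : Set (EuclideanSpace ℝ (Fin d)) → ℝ}

theorem cellFunction_of_mem (hK : K ∈ D.cells) (hx : x ∈ K) : D.cellFunction w x = w K := by
  rw [cellFunction, Finset.sum_eq_single_of_mem K hK, indicator_of_mem hx]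
  intro L hL hLK
  exact indicator_of_notMem (Set.disjoint_left.1 (D.cell_disjoint K hK L hL hLK.symm) hx) _

theorem cellFunction_of_forall_notMem (hx : ∀ K ∈ D.cells, x ∉ K) : D.cellFunction w x = 0 :=
  Finset.sum_eq_zero fun K hK => indicator_of_notMem (hx K hK) _

theorem cellFunction_eventuallyEq (hy : ∀ K ∈ D.cells, y ∉ frontier K) :
    ∀ᶠ z in 𝓝 y, D.cellFunction w z = D.cellFunction w y := by
  by_cases h : ∃ K ∈ D.cells, y ∈ K
  · obtain ⟨K, hK, hyK⟩ := h
    filter_upwards [(D.cell_isOpen K hK).mem_nhds hyK] with z hz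
    rw [cellFunction_of_mem hK hz, cellFunction_of_mem hK hyK]
  · push Not at h
    have : ∀ᶠ z in 𝓝 y, ∀ K ∈ D.cells, z ∈ (closure K)ᶜ := by
      rw [Filter.eventually_all_finset]
      intro K hK
      refine isClosed_closure.isOpen_compl.mem_nhds fun hmem => hy K hK ?_
      rw [frontier, (D.cell_isOpen K hK).interior_eq]
      exact ⟨hmem, h K hK⟩
    filter_upwards [this] with z hz
    rw [cellFunction_of_forall_notMem fun K hK hzK => hz K hK (subset_closure hzK),
      cellFunction_of_forall_notMem h]

/-- The sum of the jumps across `σ` seen from the cells that have `σ` among their edges. -/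
noncomputable def totalJump (D : Discretisation Ω) (w : Set (EuclideanSpace ℝ (Fin d)) → ℝ)
    (σ : Set (EuclideanSpace ℝ (Fin d))) : ℝ :=
  ∑ K ∈ D.cellsOf σ, D.jump w K σ

theorem jump_nonneg : 0 ≤ D.jump w K σ := abs_nonneg _

theorem totalJump_nonneg : 0 ≤ D.totalJump w σ := Finset.sum_nonneg fun _ _ => jump_nonneg

/-- Across an edge away from the ridges, a piecewise constant function varies by at most its
jump. -/
theorem IsFrame.exists_nhds_abs_sub_le (hF : D.IsFrame n c U) (hσ : σ ∈ D.edges) (hy : y ∈ σ)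
    (hyr : y ∉ D.ridges) :
    ∃ V ∈ 𝓝 y, ∀ z ∈ V, ∀ z' ∈ V, inner ℝ (n σ) z ≠ c σ → inner ℝ (n σ) z' ≠ c σ →
      |D.cellFunction w z - D.cellFunction w z'| ≤ D.totalJump w σ := by
  have hother : ∀ᶠ z in 𝓝 y, ∀ L ∈ D.cells, L ∉ D.cellsOf σ → z ∉ L := by
    rw [Filter.eventually_all_finset]
    intro L hL
    by_cases hLσ : L ∈ D.cellsOf σ
    · simp [hLσ]
    · filter_upwards [isClosed_closure.isOpen_compl.mem_nhds
        (notMem_closure_of_notMem_cellsOf hσ hy hyr hL hLσ)] with z hz _ hzL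
      exact hz (subset_closure hzL)
  have hcone : ∀ K ∈ D.cellsOf σ, ∀ᶠ z in 𝓝 y,
      0 < (inner ℝ (n σ) z - c σ) * (inner ℝ (n σ) (D.center K) - c σ) → z ∈ K := by
    intro K hKσ
    obtain ⟨hK, hσK⟩ := mem_cellsOf.1 hKσ
    have h := (hF σ hσ).2.2
    have hy' : y ∈ U σ ∩ {x | inner ℝ (n σ) x = c σ} := h ▸ hy
    filter_upwards [eventually_mem_openCone (hF.inner_center_ne hK hσK) (hF σ hσ).2.1 hy']
      with z hz hside
    have := hz hside
    rw [← h] at this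
    exact openCone_subset hK hσK this
  rcases cellsOf_eq hσ with ⟨K, hKσ⟩ | ⟨K, L, hKL, hKLσ⟩
  · refine ⟨_, hother, fun z hz z' hz' _ _ => ?_⟩
    have hJ : D.totalJump w σ = |w K| := by
      rw [totalJump, hKσ, Finset.sum_singleton, jump_of_cellsOf_eq_singleton D w hKσ]
    have hK : K ∈ D.cells := (mem_cellsOf.1 (hKσ ▸ Finset.mem_singleton_self K)).1
    have hval : ∀ z, (∀ L ∈ D.cells, L ∉ D.cellsOf σ → z ∉ L) →
        D.cellFunction w z = w K ∨ D.cellFunction w z = 0 := by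
      intro z hz
      by_cases hzK : z ∈ K
      · exact Or.inl (cellFunction_of_mem hK hzK)
      · refine Or.inr (cellFunction_of_forall_notMem fun L hL => ?_)
        by_cases hLK : L = K
        · rwa [hLK]
        · exact hz L hL (by rw [hKσ]; simpa using hLK)
    rw [hJ]
    rcases hval z hz with h | h <;> rcases hval z' hz' with h' | h' <;> rw [h, h'] <;> simp
  · have hKm : K ∈ D.cellsOf σ := by simp [hKLσ]
    have hLm : L ∈ D.cellsOf σ := by simp [hKLσ]
    have hK := (mem_cellsOf.1 hKm).1
    have hL := (mem_cellsOf.1 hLm).1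
    have hKne := hF.inner_center_ne hK (mem_cellsOf.1 hKm).2
    have hLne := hF.inner_center_ne hL (mem_cellsOf.1 hLm).2
    have hyc : inner ℝ (n σ) y = c σ := hF.closure_subset hσ (subset_closure hy)
    -- The centres lie on opposite sides of `σ`: otherwise points close to `y` on their common side
    -- would belong to both cells.
    have hopp : (inner ℝ (n σ) (D.center K) - c σ) * (inner ℝ (n σ) (D.center L) - c σ) < 0 := by
      by_contra hcon
      have hpos : 0 < (inner ℝ (n σ) (D.center K) - c σ) * (inner ℝ (n σ) (D.center L) - c σ) :=
        lt_of_le_of_ne (not_lt.1 hcon)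
          (mul_ne_zero (sub_ne_zero.2 hKne) (sub_ne_zero.2 hLne)).symm
      have hlim : Tendsto (fun t : ℝ => y + t • (D.center K - y)) (𝓝[>] 0) (𝓝 y) := by
        have : ContinuousAt (fun t : ℝ => y + t • (D.center K - y)) 0 := by fun_prop
        have := this.tendsto
        rw [zero_smul, add_zero] at this
        exact this.mono_left nhdsWithin_le_nhds
      obtain ⟨t, ⟨htK, htL⟩, ht⟩ := (((hlim.eventually (hcone K hKm)).and
        (hlim.eventually (hcone L hLm))).and self_mem_nhdsWithin).exists
      have ht0 : (0 : ℝ) < t := ht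
      have hval : inner ℝ (n σ) (y + t • (D.center K - y)) - c σ =
          t * (inner ℝ (n σ) (D.center K) - c σ) := by
        rw [inner_add_right, inner_smul_right, inner_sub_right, hyc]
        ring
      rw [hval] at htK htL
      refine Set.disjoint_left.1 (D.cell_disjoint K hK L hL hKL) (htK ?_) (htL ?_)
      · rw [mul_assoc]
        exact mul_pos ht0 (mul_self_pos.2 (sub_ne_zero.2 hKne))
      · rw [mul_assoc]
        exact mul_pos ht0 hpos
    -- Each of the two cells contributes the jump, hence the double count, which is harmless here.
    have hJ : D.totalJump w σ = |w K - w L| + |w K - w L| := by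
      classical
      obtain ⟨h1, h2⟩ := jump_of_cellsOf_eq_pair D w hKL hKLσ
      rw [totalJump, hKLσ, Finset.sum_pair hKL, h1, h2]
    have hval : ∀ᶠ z in 𝓝 y, inner ℝ (n σ) z ≠ c σ →
        D.cellFunction w z = w K ∨ D.cellFunction w z = w L := by
      filter_upwards [hcone K hKm, hcone L hLm] with z hzK hzL hz
      rcases lt_or_gt_of_ne (mul_ne_zero (sub_ne_zero.2 hz) (sub_ne_zero.2 hKne)) with h | h
      · refine Or.inr (cellFunction_of_mem hL (hzL ?_))
        have hz2 : 0 < (inner ℝ (n σ) (D.center K) - c σ) ^ 2 := by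
          have := sub_ne_zero.2 hKne
          positivity
        have := mul_pos_of_neg_of_neg h hopp
        have h3 : (inner ℝ (n σ) (D.center K) - c σ) ^ 2 *
            ((inner ℝ (n σ) z - c σ) * (inner ℝ (n σ) (D.center L) - c σ)) > 0 := by
          linarith
        exact (mul_pos_iff_of_pos_left hz2).1 h3
      · exact Or.inl (cellFunction_of_mem hK (hzK h))
    refine ⟨_, hval, fun z hz z' hz' hzc hzc' => ?_⟩
    rw [hJ]
    have h0 := abs_nonneg (w K - w L)
    have h1 := abs_sub_comm (w L) (w K)
    rcases hz hzc with h | h <;> rcases hz' hzc' with h' | h' <;> rw [h, h'] <;>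
      (try rw [sub_self, abs_zero]) <;> linarith

open Classical in
/-- On a line that avoids the ridges, a piecewise constant function is bounded by the sum of the
jumps across the edges that the line meets. -/
theorem IsFrame.abs_cellFunction_le (hF : D.IsFrame n c U) (hΩ : Bornology.IsBounded Ω)
    {e : EuclideanSpace ℝ (Fin d)} (he : e ≠ 0) (hx : ∀ σ ∈ D.edges, inner ℝ (n σ) x ≠ c σ)
    (hr : ∀ t : ℝ, x + t • e ∉ D.ridges) :
    |D.cellFunction w x| ≤
      ∑ σ ∈ D.edges.filter (fun σ => ∃ t : ℝ, x + t • e ∈ σ), D.totalJump w σ := by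
  -- Only the half-line `t < 0` is followed, from a point outside `Ω` up to `x`.
  set S := D.edges.filter fun σ => ∃ t : ℝ, t < 0 ∧ x + t • e ∈ σ with hS
  have hSe : ∀ σ ∈ S, σ ∈ D.edges := fun σ hσ => (Finset.mem_filter.1 hσ).1
  have hτ : ∀ σ, ∃ t : ℝ, σ ∈ S → t < 0 ∧ x + t • e ∈ σ := by
    intro σ
    by_cases hσ : σ ∈ S
    · obtain ⟨t, ht⟩ := (Finset.mem_filter.1 hσ).2
      exact ⟨t, fun _ => ht⟩
    · exact ⟨0, fun h => absurd h hσ⟩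
  choose τ hτ using hτ
  -- The line meets the hyperplane of `σ` but `x` is off it, so the line is transverse and meets it
  -- once.
  have huniq : ∀ σ ∈ S, ∀ t, inner ℝ (n σ) (x + t • e) = c σ → t = τ σ := by
    intro σ hσ t ht
    have h1 : inner ℝ (n σ) (x + τ σ • e) = c σ :=
      hF.closure_subset (hSe σ hσ) (subset_closure (hτ σ hσ).2)
    rw [inner_add_right, inner_smul_right] at ht h1
    have h2 : inner ℝ (n σ) e ≠ 0 := by
      intro h0
      exact hx σ (hSe σ hσ) (by simpa [h0] using h1)
    exact mul_right_cancel₀ h2 (by linarith)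
  have hfar : ∀ᶠ a : ℝ in atBot, x + a • e ∉ Ω := by
    obtain ⟨R, hR⟩ := hΩ.exists_norm_le
    filter_upwards [eventually_lt_atBot (-((R + ‖x‖) / ‖e‖)), eventually_lt_atBot 0] with a ha ha0 hmem
    have h1 := hR _ hmem
    have he' : 0 < ‖e‖ := norm_pos_iff.2 he
    have h2 : ‖a • e‖ ≤ R + ‖x‖ := by
      have := norm_sub_le (x + a • e) x
      rw [add_sub_cancel_left] at this
      linarith
    rw [norm_smul, Real.norm_eq_abs, abs_of_neg ha0, ← le_div_iff₀ he'] at h2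
    linarith
  have hbelow : ∀ᶠ a : ℝ in atBot, ∀ σ ∈ S, a < τ σ := by
    rw [Filter.eventually_all_finset]
    exact fun σ _ => eventually_lt_atBot _
  obtain ⟨a, ⟨haΩ, haτ⟩, ha0⟩ := ((hfar.and hbelow).and (eventually_le_atBot 0)).exists
  have hcont : Continuous fun t : ℝ => x + t • e := by fun_prop
  have key := abs_sub_le_sum_of_jumps S (τ := τ) (j := D.totalJump w)
    (g := fun t => D.cellFunction w (x + t • e)) (fun _ _ => totalJump_nonneg) ha0
    (fun σ hσ => ⟨haτ σ hσ, (hτ σ hσ).1⟩) ?_ ?_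
  · simp only [zero_smul, add_zero] at key
    rw [cellFunction_of_forall_notMem (x := x + a • e)
      fun K hK hmem => haΩ (D.cell_subset K hK hmem), sub_zero] at key
    refine key.trans (Finset.sum_le_sum_of_subset_of_nonneg ?_ fun _ _ _ => totalJump_nonneg)
    intro σ hσ
    obtain ⟨hσe, t, -, ht⟩ := Finset.mem_filter.1 hσ
    exact Finset.mem_filter.2 ⟨hσe, t, ht⟩
  · intro t ht hne
    refine hcont.continuousAt.eventually (cellFunction_eventuallyEq fun K hK hfr => ?_)
    obtain ⟨σ, hσK, hmem⟩ := exists_mem_edge hK hfr (hr t)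
    have hσ := D.edgesOf_subset K hK hσK
    have hc : inner ℝ (n σ) (x + t • e) = c σ := hF.closure_subset hσ (subset_closure hmem)
    have ht0 : t ≠ 0 := by
      rintro rfl
      exact hx σ hσ (by simpa using hc)
    have hσS : σ ∈ S := Finset.mem_filter.2 ⟨hσ, t, lt_of_le_of_ne ht.2 ht0, hmem⟩
    exact hne σ hσS (huniq σ hσS t hc).symm
  · intro σ hσ
    obtain ⟨V, hV, hVj⟩ := hF.exists_nhds_abs_sub_le (w := w) (hSe σ hσ) (hτ σ hσ).2 (hr _)
    refine ⟨_, hcont.continuousAt.preimage_mem_nhds hV, fun s hs s' hs' hne hne' => ?_⟩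
    exact hVj _ hs _ hs' (fun h => hne (huniq σ hσ s h)) (fun h => hne' (huniq σ hσ s' h))

end Discretisation

/-! ### Loomis–Whitney inequality and coordinate projections. -/

section MeasureLemmas

open Set

theorem LipschitzWith.euclideanHausdorffMeasure_image_le {X Y : Type*} [EMetricSpace X]
    [EMetricSpace Y] [MeasurableSpace X] [BorelSpace X] [MeasurableSpace Y] [BorelSpace Y]
    {f : X → Y} (hf : LipschitzWith 1 f) (m : ℕ) (s : Set X) :
    Measure.euclideanHausdorffMeasure m (f '' s) ≤ Measure.euclideanHausdorffMeasure m s := by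
  have h := hf.hausdorffMeasure_image_le (d := m) (Nat.cast_nonneg m) s
  rw [ENNReal.coe_one, ENNReal.one_rpow, one_mul] at h
  simp_rw [Measure.euclideanHausdorffMeasure_def, Measure.smul_apply, ENNReal.smul_def]
  gcongr

theorem volume_hyperplane {E : Type*} [NormedAddCommGroup E] [InnerProductSpace ℝ E]
    [FiniteDimensional ℝ E] [MeasurableSpace E] [BorelSpace E] {n : E} (hn : n ≠ 0) (c : ℝ) :
    volume {x : E | inner ℝ n x = c} = 0 := by
  rcases Set.eq_empty_or_nonempty {x : E | inner ℝ n x = c} with h | ⟨q, hq⟩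
  · rw [h, measure_empty]
  · refine measure_mono_null (t := (AffineSubspace.mk' q (ℝ ∙ n)ᗮ : Set E)) ?_
      (Measure.addHaar_affineSubspace _ _ ?_)
    · intro x hx
      rw [SetLike.mem_coe, AffineSubspace.mem_mk',
        Submodule.mem_orthogonal_singleton_iff_inner_right, vsub_eq_sub, inner_sub_right]
      simp only [mem_ofPred_eq] at hx hq
      rw [hx, hq, sub_self]
    · intro htop
      have hmem : q + n ∈ AffineSubspace.mk' q (ℝ ∙ n)ᗮ := htop ▸ AffineSubspace.mem_top _ _ _
      rw [AffineSubspace.mem_mk', Submodule.mem_orthogonal_singleton_iff_inner_right, vsub_eq_sub,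
        add_sub_cancel_left, inner_self_eq_zero] at hmem
      exact hn hmem

/-- An additive form of the Loomis–Whitney inequality. -/
theorem lintegral_prod_removeNth_rpow_le {m : ℕ} (hm : 0 < m)
    {ψ : Fin (m + 1) → (Fin m → ℝ) → ℝ≥0∞} (hψ : ∀ i, Measurable (ψ i)) :
    ∫⁻ x : Fin (m + 1) → ℝ, ∏ i, ψ i (i.removeNth x) ^ (1 / (m : ℝ)) ≤
      (∑ i, ∫⁻ y, ψ i y) ^ ((m + 1 : ℝ) / m) := by
  have hm' : (0 : ℝ) < m := Nat.cast_pos.2 hm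
  -- The unit interval has length `1`, so the integral of `f` along direction `i` is at least `ψ i`,
  -- while its full integral is `∑ i, ∫⁻ y, ψ i y`. The grid-lines inequality for `f` thus gives the
  -- claim.
  set f : (Fin (m + 1) → ℝ) → ℝ≥0∞ := fun x =>
    ∑ i, (Ico (0 : ℝ) 1).indicator 1 (x i) * ψ i (i.removeNth x) with hf
  have hind : Measurable ((Ico (0 : ℝ) 1).indicator (1 : ℝ → ℝ≥0∞)) :=
    measurable_one.indicator measurableSet_Ico
  have hrem : ∀ i : Fin (m + 1), Measurable fun x : Fin (m + 1) → ℝ => i.removeNth x :=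
    fun i => measurable_pi_lambda _ fun k => measurable_pi_apply _
  have hfm : Measurable f := by
    refine Finset.measurable_sum _ fun i _ => ?_
    exact (hind.comp (measurable_pi_apply i)).mul ((hψ i).comp (hrem i))
  have hone : ∫⁻ t : ℝ, (Ico (0 : ℝ) 1).indicator (1 : ℝ → ℝ≥0∞) t = 1 := by
    rw [lintegral_indicator_one measurableSet_Ico, Real.volume_Ico]
    simp
  have hp : Real.HolderConjugate (Fintype.card (Fin (m + 1))) ((m + 1 : ℝ) / m) := by
    rw [Real.holderConjugate_iff, Fintype.card_fin]
    push_cast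
    refine ⟨by linarith, ?_⟩
    field_simp
    ring
  have key := lintegral_prod_lintegral_pow_le (fun _ : Fin (m + 1) => (volume : Measure ℝ)) hp hfm
  rw [← volume_pi, Fintype.card_fin] at key
  push_cast at key
  rw [add_sub_cancel_right] at key
  refine le_trans (lintegral_mono fun x => ?_) (key.trans_eq ?_)
  · refine Finset.prod_le_prod' fun i _ => ?_
    refine ENNReal.rpow_le_rpow ?_ (by positivity)
    calc ψ i (i.removeNth x)
        = ∫⁻ t : ℝ, (Ico (0 : ℝ) 1).indicator 1 t * ψ i (i.removeNth x) := by
          rw [lintegral_mul_const _ hind, hone, one_mul]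
      _ ≤ ∫⁻ t : ℝ, f (Function.update x i t) := by
          refine lintegral_mono fun t => ?_
          refine le_trans (le_of_eq ?_) (Finset.single_le_sum (fun _ _ => zero_le) (Finset.mem_univ i))
          rw [Function.update_self, Fin.removeNth_update]
  · congr 1
    rw [lintegral_finsetSum]
    · refine Finset.sum_congr rfl fun i _ => ?_
      have hmp := volume_preserving_piFinSuccAbove (fun _ : Fin (m + 1) => ℝ) i
      have := hmp.lintegral_comp_emb (MeasurableEquiv.measurableEmbedding _)
        fun z : ℝ × (Fin m → ℝ) => (Ico (0 : ℝ) 1).indicator 1 z.1 * ψ i z.2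
      simp only [MeasurableEquiv.piFinSuccAbove_apply, Fin.insertNthEquiv_symm_apply] at this
      rw [this, Measure.volume_eq_prod,
        lintegral_prod_mul hind.aemeasurable (hψ i).aemeasurable, hone, one_mul]
    · intro i _
      exact (hind.comp (measurable_pi_apply i)).mul ((hψ i).comp (hrem i))

/-- The projection of `ℝ^(m+1)` onto `ℝ^m` that forgets the coordinate `i`. -/
def dropCoord {m : ℕ} (i : Fin (m + 1)) (x : EuclideanSpace ℝ (Fin (m + 1))) :
    EuclideanSpace ℝ (Fin m) :=
  WithLp.toLp 2 (i.removeNth x.ofLp)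

theorem lipschitzWith_dropCoord {m : ℕ} (i : Fin (m + 1)) : LipschitzWith 1 (dropCoord i) := by
  refine LipschitzWith.of_dist_le_mul fun x y => ?_
  rw [NNReal.coe_one, one_mul, EuclideanSpace.dist_eq, EuclideanSpace.dist_eq]
  refine Real.sqrt_le_sqrt ?_
  rw [Fin.sum_univ_succAbove _ i]
  exact le_add_of_nonneg_left (sq_nonneg _)

theorem dropCoord_add_smul_single {m : ℕ} (i : Fin (m + 1)) (x : EuclideanSpace ℝ (Fin (m + 1)))
    (t : ℝ) : dropCoord i (x + t • EuclideanSpace.single i 1) = dropCoord i x := by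
  ext k
  simp [dropCoord, Fin.removeNth]

/-- This turns a null set of projections into a null set of lines. -/
theorem quasiMeasurePreserving_dropCoord {m : ℕ} (i : Fin (m + 1)) :
    Measure.QuasiMeasurePreserving (dropCoord i) volume volume := by
  have h1 := (PiLp.volume_preserving_toLp (Fin m)).quasiMeasurePreserving
  have h2 : Measure.QuasiMeasurePreserving (Prod.snd : ℝ × (Fin m → ℝ) → _) volume volume :=
    Measure.quasiMeasurePreserving_snd
  have h3 := (volume_preserving_piFinSuccAbove (fun _ : Fin (m + 1) => ℝ) i).quasiMeasurePreserving
  have h4 := (PiLp.volume_preserving_ofLp (Fin (m + 1))).quasiMeasurePreserving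
  exact h1.comp (h2.comp (h3.comp h4))

theorem volume_image_dropCoord_le {m : ℕ} (i : Fin (m + 1))
    (s : Set (EuclideanSpace ℝ (Fin (m + 1)))) :
    volume (dropCoord i '' s) ≤ Measure.euclideanHausdorffMeasure m s := by
  rw [← EuclideanSpace.euclideanHausdorffMeasure_eq_volume]
  exact (lipschitzWith_dropCoord i).euclideanHausdorffMeasure_image_le m s

end MeasureLemmas

/-! ### The case `p = 1`, and cell volumes. -/

namespace Discretisation

open Set Filter Topology

variable {m : ℕ} {Ω : Set (EuclideanSpace ℝ (Fin (m + 1)))} {D : Discretisation Ω}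
  {w : Set (EuclideanSpace ℝ (Fin (m + 1))) → ℝ} {K σ : Set (EuclideanSpace ℝ (Fin (m + 1)))}

theorem measurable_cellFunction : Measurable (D.cellFunction w) :=
  Finset.measurable_sum _ fun K hK =>
    measurable_const.indicator (D.cell_isOpen K hK).measurableSet

theorem ae_notMem_closure_edge : ∀ᵐ x, ∀ σ ∈ D.edges, x ∉ closure σ := by
  obtain ⟨n, c, U, hF⟩ := D.exists_isFrame
  rw [Finset.eventually_all]
  intro σ hσ
  exact measure_mono_null (fun x hx => hF.closure_subset hσ (by simpa using hx))
    (volume_hyperplane (hF σ hσ).1 (c σ))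

/-- The ridges are `m`-dimensionally negligible, so their projection along axis `i` is a null set in
`ℝ^m`; a line meets the ridges only if it projects into that set. -/
theorem ae_notMem_ridges (i : Fin (m + 1)) :
    ∀ᵐ x, ∀ t : ℝ, x + t • EuclideanSpace.single i 1 ∉ D.ridges := by
  have h0 : Measure.euclideanHausdorffMeasure m D.ridges = 0 := by
    refine (measure_biUnion_null_iff D.edges.countable_toSet).2 fun σ hσ => ?_
    exact D.edge_boundary_null σ hσ
  have h1 : volume (dropCoord i '' D.ridges) = 0 :=
    le_antisymm ((volume_image_dropCoord_le i _).trans_eq h0) zero_le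
  have h2 : ∀ᵐ x, dropCoord i x ∉ dropCoord i '' D.ridges :=
    (quasiMeasurePreserving_dropCoord i).ae (measure_eq_zero_iff_ae_notMem.1 h1)
  filter_upwards [h2] with x hx t ht
  exact hx ⟨_, ht, dropCoord_add_smul_single i x t⟩

/-- The bound along direction `i` is written as a function of `dropCoord i x` alone, as the
Loomis–Whitney inequality requires. `toMeasurable` makes it measurable without changing the measure
of the projected edges. -/
theorem ae_enorm_cellFunction_le (hΩ : Bornology.IsBounded Ω) :
    ∀ᵐ x, ∀ i, ‖D.cellFunction w x‖ₑ ≤ ∑ σ ∈ D.edges, ENNReal.ofReal (D.totalJump w σ) *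
      (toMeasurable volume (dropCoord i '' σ)).indicator 1 (dropCoord i x) := by
  classical
  obtain ⟨n, c, U, hF⟩ := D.exists_isFrame
  have hH : ∀ᵐ x, ∀ σ ∈ D.edges, inner ℝ (n σ) x ≠ c σ := by
    rw [Finset.eventually_all]
    intro σ hσ
    exact measure_eq_zero_iff_ae_notMem.1 (volume_hyperplane (hF σ hσ).1 (c σ))
  filter_upwards [hH, ae_all_iff.2 fun i => ae_notMem_ridges (D := D) i] with x hx hr i
  have h := hF.abs_cellFunction_le (w := w) hΩ (e := EuclideanSpace.single i 1) (by simp) hx (hr i)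
  rw [← ofReal_norm, Real.norm_eq_abs]
  refine (ENNReal.ofReal_le_ofReal h).trans ?_
  rw [ENNReal.ofReal_sum_of_nonneg fun _ _ => totalJump_nonneg, Finset.sum_filter]
  refine Finset.sum_le_sum fun σ _ => ?_
  split_ifs with hσ
  · obtain ⟨t, ht⟩ := hσ
    rw [indicator_of_mem, Pi.one_apply, mul_one]
    exact subset_toMeasurable _ _ ⟨_, ht, dropCoord_add_smul_single i x t⟩
  · exact zero_le

/-- The discrete Sobolev inequality for `p = 1`. -/
theorem lintegral_cellFunction_rpow_le (hm : 0 < m) (hΩ : Bornology.IsBounded Ω) :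
    ∫⁻ x, ‖D.cellFunction w x‖ₑ ^ ((m + 1 : ℝ) / m) ≤
      ((m + 1) * ∑ σ ∈ D.edges, ENNReal.ofReal (D.totalJump w σ) *
        Measure.euclideanHausdorffMeasure m σ) ^ ((m + 1 : ℝ) / m) := by
  set A : Fin (m + 1) → Set (EuclideanSpace ℝ (Fin (m + 1))) → Set (EuclideanSpace ℝ (Fin m)) :=
    fun i σ => toMeasurable volume (dropCoord i '' σ) with hA
  have hAm : ∀ i σ, Measurable ((A i σ).indicator (1 : EuclideanSpace ℝ (Fin m) → ℝ≥0∞)) :=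
    fun i σ => measurable_one.indicator (measurableSet_toMeasurable _ _)
  have htoLp := (PiLp.volume_preserving_toLp (Fin m)).measurable
  have hAc : ∀ i σ, Measurable fun y : Fin m → ℝ =>
      (A i σ).indicator (1 : EuclideanSpace ℝ (Fin m) → ℝ≥0∞) (WithLp.toLp 2 y) :=
    fun i σ => (hAm i σ).comp htoLp
  set ψ : Fin (m + 1) → (Fin m → ℝ) → ℝ≥0∞ := fun i y =>
    ∑ σ ∈ D.edges, ENNReal.ofReal (D.totalJump w σ) * (A i σ).indicator 1 (WithLp.toLp 2 y) with hψ
  have hψm : ∀ i, Measurable (ψ i) := fun i =>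
    Finset.measurable_sum _ fun σ _ => (hAc i σ).const_mul _
  have hint : ∀ i, ∫⁻ y, ψ i y ≤ ∑ σ ∈ D.edges, ENNReal.ofReal (D.totalJump w σ) *
      Measure.euclideanHausdorffMeasure m σ := by
    intro i
    simp only [hψ]
    rw [lintegral_finsetSum _ fun σ _ => (hAc i σ).const_mul _]
    refine Finset.sum_le_sum fun σ _ => ?_
    rw [lintegral_const_mul _ (hAc i σ)]
    gcongr
    rw [(PiLp.volume_preserving_toLp (Fin m)).lintegral_comp (hAm i σ),
      lintegral_indicator_one (measurableSet_toMeasurable _ _), measure_toMeasurable]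
    exact volume_image_dropCoord_le i σ
  have hm' : (m : ℝ) ≠ 0 := Nat.cast_ne_zero.2 hm.ne'
  rw [← (PiLp.volume_preserving_toLp (Fin (m + 1))).lintegral_comp
    (measurable_cellFunction.enorm.pow_const _)]
  calc ∫⁻ x : Fin (m + 1) → ℝ, ‖D.cellFunction w (WithLp.toLp 2 x)‖ₑ ^ ((m + 1 : ℝ) / m)
      ≤ ∫⁻ x : Fin (m + 1) → ℝ, ∏ i, ψ i (i.removeNth x) ^ (1 / (m : ℝ)) := by
        have hae := (PiLp.volume_preserving_toLp (Fin (m + 1))).quasiMeasurePreserving.ae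
          (ae_enorm_cellFunction_le (D := D) (w := w) hΩ)
        refine lintegral_mono_ae ?_
        filter_upwards [hae] with x hx
        -- The power `(m + 1) / m` is split into `m + 1` factors of exponent `1 / m`, one bounded
        -- along each axis.
        calc ‖D.cellFunction w (WithLp.toLp 2 x)‖ₑ ^ ((m + 1 : ℝ) / m)
            = ∏ _i : Fin (m + 1), ‖D.cellFunction w (WithLp.toLp 2 x)‖ₑ ^ (1 / (m : ℝ)) := by
              rw [Finset.prod_const, Finset.card_univ, Fintype.card_fin, ← ENNReal.rpow_natCast,
                ← ENNReal.rpow_mul]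
              congr 1
              push_cast
              ring
          _ ≤ _ := Finset.prod_le_prod' fun i _ =>
              ENNReal.rpow_le_rpow (hx i) (by positivity)
    _ ≤ (∑ i, ∫⁻ y, ψ i y) ^ ((m + 1 : ℝ) / m) := lintegral_prod_removeNth_rpow_le hm hψm
    _ ≤ _ := by
        refine ENNReal.rpow_le_rpow ?_ (by positivity)
        refine (Finset.sum_le_sum fun i _ => hint i).trans_eq ?_
        rw [Finset.sum_const, Finset.card_univ, Fintype.card_fin, nsmul_eq_mul]
        push_cast
        rfl

theorem volume_cell_ne_top (hΩ : Bornology.IsBounded Ω) (hK : K ∈ D.cells) : volume K ≠ ∞ :=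
  ((hΩ.subset (D.cell_subset K hK)).measure_lt_top).ne

/-- The cones from the centre over the edges are disjoint and contained in `K`, and each bounds its
own term. -/
theorem sum_edge_measure_mul_cellDist_le (hK : K ∈ D.cells) :
    ∑ σ ∈ D.edgesOf K, Measure.euclideanHausdorffMeasure m σ * ENNReal.ofReal (D.cellDist K σ) ≤
      2 ^ (m + 1) * volume K := by
  obtain ⟨n, c, U, hF⟩ := D.exists_isFrame
  calc _ ≤ ∑ σ ∈ D.edgesOf K, 2 ^ (m + 1) * volume (openCone (D.center K) σ) := by
        refine Finset.sum_le_sum fun σ hσ => ?_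
        have hσe := D.edgesOf_subset K hK hσ
        have h := measure_mul_infDist_le_volume_openCone (hF σ hσe).1 (hF.inner_center_ne hK hσ)
          (hF σ hσe).2.1
        rw [← (hF σ hσe).2.2] at h
        refine le_trans ?_ h
        gcongr
        exact hF.cellDist_le hσe
    _ = 2 ^ (m + 1) * volume (⋃ σ ∈ D.edgesOf K, openCone (D.center K) σ) := by
        rw [← Finset.mul_sum, measure_biUnion_finset]
        · exact fun σ hσ τ hτ h => disjoint_openCone hK hσ hτ h
        · intro σ hσ
          have hσe := D.edgesOf_subset K hK hσ
          have := measurableSet_openCone (hF.inner_center_ne hK hσ) (hF σ hσe).2.1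
          rwa [← (hF σ hσe).2.2] at this
    _ ≤ _ := by
        gcongr
        exact iUnion₂_subset fun σ hσ => openCone_subset hK hσ

/-- The cone over `σ` lies in a cell of finite volume and has positive height. -/
theorem edge_measure_ne_top (hΩ : Bornology.IsBounded Ω) (hσ : σ ∈ D.edges) :
    Measure.euclideanHausdorffMeasure m σ ≠ ∞ := by
  obtain ⟨K, hKσ⟩ := cellsOf_nonempty hσ
  obtain ⟨hK, hσK⟩ := mem_cellsOf.1 hKσ
  have h1 := (Finset.single_le_sum (f := fun σ => Measure.euclideanHausdorffMeasure m σ *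
    ENNReal.ofReal (D.cellDist K σ)) (fun _ _ => zero_le) hσK).trans
      (sum_edge_measure_mul_cellDist_le hK)
  intro htop
  have hpos : ENNReal.ofReal (D.cellDist K σ) ≠ 0 := by
    rw [Ne, ENNReal.ofReal_eq_zero, not_le]
    exact D.dist_pos K hK σ hσK
  simp only [htop, ENNReal.top_mul hpos, top_le_iff] at h1
  exact ENNReal.mul_ne_top (by simp) (volume_cell_ne_top hΩ hK) h1

theorem lintegral_cellFunction_rpow {q : ℝ} (hq : 0 < q) (hΩ : Bornology.IsBounded Ω) :
    ∫⁻ x, ‖D.cellFunction w x‖ₑ ^ q =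
      ENNReal.ofReal (∑ K ∈ D.cells, volume.real K * |w K| ^ q) := by
  have h : ∀ x, ‖D.cellFunction w x‖ₑ ^ q =
      ∑ K ∈ D.cells, K.indicator (fun _ => ‖w K‖ₑ ^ q) x := by
    intro x
    by_cases hx : ∃ K ∈ D.cells, x ∈ K
    · obtain ⟨K, hK, hxK⟩ := hx
      rw [cellFunction_of_mem hK hxK, Finset.sum_eq_single_of_mem K hK, indicator_of_mem hxK]
      intro L hL hLK
      exact indicator_of_notMem (Set.disjoint_left.1 (D.cell_disjoint K hK L hL hLK.symm) hxK) _
    · push Not at hx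
      rw [cellFunction_of_forall_notMem hx, enorm_zero, ENNReal.zero_rpow_of_pos hq]
      exact (Finset.sum_eq_zero fun K hK => indicator_of_notMem (hx K hK) _).symm
  simp_rw [h]
  rw [lintegral_finsetSum _ fun K hK =>
    measurable_const.indicator (D.cell_isOpen K hK).measurableSet,
    ENNReal.ofReal_sum_of_nonneg fun K _ => by positivity]
  refine Finset.sum_congr rfl fun K hK => ?_
  rw [lintegral_indicator_const (D.cell_isOpen K hK).measurableSet,
    ENNReal.ofReal_mul measureReal_nonneg, ofReal_measureReal (volume_cell_ne_top hΩ hK),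
    ← ofReal_norm, Real.norm_eq_abs, ENNReal.ofReal_rpow_of_nonneg (abs_nonneg _) hq.le, mul_comm]

theorem sum_cells_edgesOf_eq (F : Set (EuclideanSpace ℝ (Fin (m + 1))) →
    Set (EuclideanSpace ℝ (Fin (m + 1))) → ℝ) :
    ∑ K ∈ D.cells, ∑ σ ∈ D.edgesOf K, F K σ = ∑ σ ∈ D.edges, ∑ K ∈ D.cellsOf σ, F K σ := by
  refine Finset.sum_comm' fun K σ => ?_
  rw [mem_cellsOf]
  exact ⟨fun h => ⟨h, D.edgesOf_subset K h.1 h.2⟩, fun h => h.1⟩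

theorem sum_cells_rpow_le (hm : 0 < m) (hΩ : Bornology.IsBounded Ω) :
    (∑ K ∈ D.cells, volume.real K * |w K| ^ ((m + 1 : ℝ) / m)) ^ ((m : ℝ) / (m + 1)) ≤
      (m + 1) * ∑ σ ∈ D.edges, ∑ K ∈ D.cellsOf σ,
        (Measure.euclideanHausdorffMeasure m).real σ * D.jump w K σ := by
  have hm' : (0 : ℝ) < m := Nat.cast_pos.2 hm
  set R := (m + 1) * ∑ σ ∈ D.edges, ∑ K ∈ D.cellsOf σ,
        (Measure.euclideanHausdorffMeasure m).real σ * D.jump w K σ with hR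
  have hR0 : 0 ≤ R := by
    refine mul_nonneg (by positivity) (Finset.sum_nonneg fun σ _ => Finset.sum_nonneg fun K _ => ?_)
    exact mul_nonneg measureReal_nonneg jump_nonneg
  have hRe : (m + 1) * ∑ σ ∈ D.edges, ENNReal.ofReal (D.totalJump w σ) *
        Measure.euclideanHausdorffMeasure m σ = ENNReal.ofReal R := by
    rw [hR, ENNReal.ofReal_mul (by positivity), ENNReal.ofReal_sum_of_nonneg]
    · congr 1
      · rw [ENNReal.ofReal_add (by positivity) (by positivity)]
        simp
      · refine Finset.sum_congr rfl fun σ hσ => ?_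
        rw [← Finset.mul_sum, ENNReal.ofReal_mul measureReal_nonneg,
          ofReal_measureReal (edge_measure_ne_top hΩ hσ), mul_comm]
        rfl
    · exact fun σ _ => Finset.sum_nonneg fun K _ => mul_nonneg measureReal_nonneg jump_nonneg
  have h := lintegral_cellFunction_rpow_le (D := D) (w := w) hm hΩ
  rw [lintegral_cellFunction_rpow (by positivity) hΩ, hRe,
    ENNReal.ofReal_rpow_of_nonneg hR0 (by positivity),
    ENNReal.ofReal_le_ofReal_iff (by positivity)] at h
  calc _ ≤ (R ^ ((m + 1 : ℝ) / m)) ^ ((m : ℝ) / (m + 1)) := by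
        refine Real.rpow_le_rpow ?_ h (by positivity)
        exact Finset.sum_nonneg fun K _ => by positivity
    _ = R := by
        rw [← Real.rpow_mul hR0]
        have : (m + 1 : ℝ) / m * (m / (m + 1)) = 1 := by field_simp
        rw [this, Real.rpow_one]

end Discretisation

/-! ### From `p = 1` to general `p`. -/

/-- For `b ≤ a`, Bernoulli's inequality at `b / a` yields `a ^ γ - b ^ γ ≤ γ a ^ (γ - 1) (a - b)`;
the second power makes the bound symmetric. -/
theorem abs_rpow_sub_rpow_le {a b γ : ℝ} (ha : 0 ≤ a) (hb : 0 ≤ b) (hγ : 1 ≤ γ) :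
    |a ^ γ - b ^ γ| ≤ γ * (a ^ (γ - 1) + b ^ (γ - 1)) * |a - b| := by
  wlog hab : b ≤ a generalizing a b
  · have := this hb ha (le_of_not_ge hab)
    rwa [abs_sub_comm, abs_sub_comm b a, add_comm (b ^ (γ - 1))] at this
  rw [abs_of_nonneg (sub_nonneg.2 (Real.rpow_le_rpow hb hab (by linarith))),
    abs_of_nonneg (sub_nonneg.2 hab)]
  rcases ha.eq_or_lt with rfl | ha0
  · simp [le_antisymm hab hb]
  have h1 : 1 + γ * (b / a - 1) ≤ (b / a) ^ γ := by
    have := one_add_mul_self_le_rpow_one_add (s := b / a - 1)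
      (by linarith [div_nonneg hb ha]) hγ
    rwa [add_sub_cancel] at this
  have h2 : a ^ γ = a ^ (γ - 1) * a := by
    rw [← Real.rpow_add_one ha0.ne', sub_add_cancel]
  rw [Real.div_rpow hb ha, le_div_iff₀ (by positivity)] at h1
  have h3 : (1 + γ * (b / a - 1)) * a ^ γ = a ^ γ + γ * a ^ (γ - 1) * (b - a) := by
    rw [h2]
    field_simp
  have h4 : 0 ≤ γ * b ^ (γ - 1) * (a - b) :=
    mul_nonneg (by positivity) (sub_nonneg.2 hab)
  nlinarith

namespace Discretisation

open Set

section

variable {d : ℕ} {Ω : Set (EuclideanSpace ℝ (Fin d))} {D : Discretisation Ω}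
  {v : Set (EuclideanSpace ℝ (Fin d)) → ℝ} {K σ : Set (EuclideanSpace ℝ (Fin d))}

/-- The estimate holds only after summing over the cells of `σ`: for `γ > 1` the term of a cell with
`v K = 0` vanishes on the right but not, in general, on the left. -/
theorem sum_jump_rpow_le {γ : ℝ} (hγ : 1 ≤ γ) (hσ : σ ∈ D.edges) :
    ∑ K ∈ D.cellsOf σ, D.jump (fun K => |v K| ^ γ) K σ ≤
      2 * γ * ∑ K ∈ D.cellsOf σ, |v K| ^ (γ - 1) * D.jump v K σ := by
  rcases cellsOf_eq hσ with ⟨K, h⟩ | ⟨K, L, hKL, h⟩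
  · rw [h, Finset.sum_singleton, Finset.sum_singleton, jump_of_cellsOf_eq_singleton D _ h,
      jump_of_cellsOf_eq_singleton D _ h, abs_of_nonneg (by positivity)]
    have h1 : |v K| ^ (γ - 1) * |v K| = |v K| ^ γ := by
      rcases (abs_nonneg (v K)).eq_or_lt with h0 | h0
      · rw [← h0, mul_zero, Real.zero_rpow (by linarith)]
      · rw [← Real.rpow_add_one h0.ne', sub_add_cancel]
    rw [h1]
    exact le_mul_of_one_le_left (by positivity) (by linarith)
  · classical
    obtain ⟨h1, h2⟩ := jump_of_cellsOf_eq_pair D v hKL h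
    obtain ⟨h3, h4⟩ := jump_of_cellsOf_eq_pair D (fun K => |v K| ^ γ) hKL h
    rw [h, Finset.sum_pair hKL, Finset.sum_pair hKL, h1, h2, h3, h4]
    have h5 := abs_rpow_sub_rpow_le (abs_nonneg (v K)) (abs_nonneg (v L)) hγ
    have h6 : γ * (|v K| ^ (γ - 1) + |v L| ^ (γ - 1)) * |(|v K| - |v L|)| ≤
        γ * (|v K| ^ (γ - 1) + |v L| ^ (γ - 1)) * |v K - v L| := by
      exact mul_le_mul_of_nonneg_left (abs_abs_sub_abs_le_abs_sub _ _) (by positivity)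
    linarith

theorem cellDist_pos (hK : K ∈ D.cells) (hσ : σ ∈ D.edgesOf K) : 0 < D.cellDist K σ :=
  D.dist_pos K hK σ hσ

theorem cellDist_nonneg : 0 ≤ D.cellDist K σ := Metric.infDist_nonneg

theorem edgeDist_nonneg : 0 ≤ D.edgeDist σ := Finset.sum_nonneg fun _ _ => cellDist_nonneg

theorem cellDist_le_edgeDist (hKσ : K ∈ D.cellsOf σ) : D.cellDist K σ ≤ D.edgeDist σ :=
  Finset.single_le_sum (f := fun K => D.cellDist K σ) (fun _ _ => cellDist_nonneg) hKσ

/-- This is where regularity enters: it trades `d_σ`, which the discrete norm has in its quotients,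
for the `d_{K,σ}` that sum up to cell volumes. -/
theorem IsRegular.edgeDist_le {η : ℝ} (hη : 0 < η) (hD : D.IsRegular η) (hσ : σ ∈ D.edges)
    (hKσ : K ∈ D.cellsOf σ) : D.edgeDist σ ≤ (1 + 1 / η) * D.cellDist K σ := by
  have key : ∀ L ∈ D.cellsOf σ, K ≠ L → D.cellDist L σ ≤ 1 / η * D.cellDist K σ := by
    intro L hL hKL
    have h := (hD σ hσ L hL K hKσ hKL.symm).2
    obtain ⟨hK, hσK⟩ := mem_cellsOf.1 hKσ
    rwa [div_le_iff₀ (cellDist_pos hK hσK)] at h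
  rw [add_mul, one_mul]
  rcases cellsOf_eq hσ with ⟨K', h⟩ | ⟨K', L, hKL, h⟩
  · obtain rfl : K = K' := by simpa [h] using hKσ
    rw [edgeDist, h, Finset.sum_singleton]
    exact le_add_of_nonneg_right (mul_nonneg (by positivity) cellDist_nonneg)
  · rw [edgeDist, h, Finset.sum_pair hKL]
    have hmem : K = K' ∨ K = L := by simpa [h] using hKσ
    rcases hmem with rfl | rfl
    · exact add_le_add le_rfl (key L (by simp [h]) hKL)
    · rw [add_comm]
      exact add_le_add le_rfl (key K' (by simp [h]) hKL.symm)

end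

variable {m : ℕ} {Ω : Set (EuclideanSpace ℝ (Fin (m + 1)))} {D : Discretisation Ω}
  {v : Set (EuclideanSpace ℝ (Fin (m + 1))) → ℝ}

/-- The cells cover `Ω` up to the closed edges, which lie in hyperplanes and hence are null. -/
theorem ae_eq_cellFunction (hΩ : IsOpen Ω) {u : EuclideanSpace ℝ (Fin (m + 1)) → ℝ}
    (hu : D.HasCellValues u v) : u =ᵐ[volume.restrict Ω] D.cellFunction v := by
  have hcells : ∀ᵐ x, ∀ K ∈ D.cells, x ∈ K → u x = v K := by
    rw [Finset.eventually_all]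
    exact fun K hK => (ae_restrict_iff' (D.cell_isOpen K hK).measurableSet).1 (hu K hK)
  filter_upwards [ae_restrict_of_ae hcells, ae_restrict_of_ae (ae_notMem_closure_edge (D := D)),
    ae_restrict_mem hΩ.measurableSet] with x hx hxσ hxΩ
  have hxc : x ∈ ⋃ K ∈ D.cells, closure K := D.closure_eq ▸ subset_closure hxΩ
  obtain ⟨K, hK, hxK⟩ := mem_iUnion₂.1 hxc
  have hmem : x ∈ K := by
    by_contra hnot
    have hfr : x ∈ frontier K := by
      rw [frontier, (D.cell_isOpen K hK).interior_eq]
      exact ⟨hxK, hnot⟩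
    rw [D.frontier_cell K hK] at hfr
    obtain ⟨σ, hσ, hmem⟩ := mem_iUnion₂.1 hfr
    exact hxσ σ (D.edgesOf_subset K hK hσ) hmem
  rw [hx K hK hmem, cellFunction_of_mem hK hmem]

/-- Hölder's inequality with exponents `p / (p - 1)` and `p` for the weights `|σ| d_{K,σ}`, which
are split as `(p - 1) / p + 1 / p` between `f` and `g`. -/
theorem sum_measure_mul_jump_le {p : ℝ} (hp : 1 < p) {η : ℝ} (hη : 0 < η) (hD : D.IsRegular η)
    (hΩ : Bornology.IsBounded Ω) {q r : ℝ} (hr : r * (p / (p - 1)) = q) :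
    ∑ K ∈ D.cells, ∑ σ ∈ D.edgesOf K,
        (Measure.euclideanHausdorffMeasure m).real σ * (|v K| ^ r * D.jump v K σ) ≤
      (1 + 1 / η) * ((2 ^ (m + 1) * ∑ K ∈ D.cells, volume.real K * |v K| ^ q) ^ ((p - 1) / p) *
        D.discreteNorm p v) := by
  have hp0 : 0 < p := by linarith
  have hp1 : 0 < p - 1 := by linarith
  have hpq : Real.HolderConjugate (p / (p - 1)) p := by
    rw [Real.holderConjugate_iff, lt_div_iff₀ hp1]
    refine ⟨by linarith, ?_⟩
    field_simp
    ring
  set T := D.cells.sigma D.edgesOf with hT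
  have hTmem : ∀ t ∈ T, t.1 ∈ D.cells ∧ t.2 ∈ D.edgesOf t.1 := fun t ht => Finset.mem_sigma.1 ht
  set M : Set (EuclideanSpace ℝ (Fin (m + 1))) → ℝ :=
    fun σ => (Measure.euclideanHausdorffMeasure m).real σ with hM
  have hM0 : ∀ σ, 0 ≤ M σ := fun σ => measureReal_nonneg
  set f : (Σ _ : Set (EuclideanSpace ℝ (Fin (m + 1))), Set (EuclideanSpace ℝ (Fin (m + 1)))) → ℝ :=
    fun t => (M t.2 * D.cellDist t.1 t.2) ^ ((p - 1) / p) * |v t.1| ^ r with hf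
  set g : (Σ _ : Set (EuclideanSpace ℝ (Fin (m + 1))), Set (EuclideanSpace ℝ (Fin (m + 1)))) → ℝ :=
    fun t => (M t.2 * D.cellDist t.1 t.2) ^ (1 / p) * (D.jump v t.1 t.2 / D.edgeDist t.2) with hg
  have hMd : ∀ K σ, 0 ≤ M σ * D.cellDist K σ := fun K σ => mul_nonneg (hM0 σ) cellDist_nonneg
  have hjd : ∀ K σ, 0 ≤ D.jump v K σ / D.edgeDist σ :=
    fun K σ => div_nonneg jump_nonneg edgeDist_nonneg
  have hf0 : ∀ t ∈ T, 0 ≤ f t := fun t _ =>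
    mul_nonneg (Real.rpow_nonneg (hMd _ _) _) (Real.rpow_nonneg (abs_nonneg _) _)
  have hg0 : ∀ t ∈ T, 0 ≤ g t := fun t _ =>
    mul_nonneg (Real.rpow_nonneg (hMd _ _) _) (hjd _ _)
  have hholder := Real.inner_le_Lp_mul_Lq_of_nonneg T hpq hf0 hg0
  have hterm : ∀ t ∈ T, M t.2 * (|v t.1| ^ r * D.jump v t.1 t.2) ≤ (1 + 1 / η) * (f t * g t) := by
    intro t ht
    obtain ⟨hK, hσ⟩ := hTmem t ht
    have hσe := D.edgesOf_subset _ hK hσ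
    have hKσ : t.1 ∈ D.cellsOf t.2 := mem_cellsOf.2 ⟨hK, hσ⟩
    have hd0 := cellDist_pos hK hσ
    have he0 : 0 < D.edgeDist t.2 := hd0.trans_le (cellDist_le_edgeDist hKσ)
    have hfg : f t * g t = M t.2 * D.cellDist t.1 t.2 * |v t.1| ^ r *
        (D.jump v t.1 t.2 / D.edgeDist t.2) := by
      have : (M t.2 * D.cellDist t.1 t.2) ^ ((p - 1) / p) *
          (M t.2 * D.cellDist t.1 t.2) ^ (1 / p) = M t.2 * D.cellDist t.1 t.2 := by
        rw [← Real.rpow_add_of_nonneg (hMd _ _) (by positivity) (by positivity)]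
        have : (p - 1) / p + 1 / p = 1 := by field_simp; ring
        rw [this, Real.rpow_one]
      calc f t * g t = ((M t.2 * D.cellDist t.1 t.2) ^ ((p - 1) / p) *
          (M t.2 * D.cellDist t.1 t.2) ^ (1 / p)) * |v t.1| ^ r *
            (D.jump v t.1 t.2 / D.edgeDist t.2) := by simp only [hf, hg]; ring
        _ = _ := by rw [this]
    rw [hfg]
    have hreg := hD.edgeDist_le hη hσe hKσ
    have hnn : 0 ≤ M t.2 * |v t.1| ^ r * (D.jump v t.1 t.2 / D.edgeDist t.2) :=
      mul_nonneg (mul_nonneg (hM0 _) (by positivity)) (hjd _ _)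
    calc M t.2 * (|v t.1| ^ r * D.jump v t.1 t.2)
        = M t.2 * |v t.1| ^ r * (D.jump v t.1 t.2 / D.edgeDist t.2) * D.edgeDist t.2 := by
          field_simp
      _ ≤ M t.2 * |v t.1| ^ r * (D.jump v t.1 t.2 / D.edgeDist t.2) *
          ((1 + 1 / η) * D.cellDist t.1 t.2) := by gcongr
      _ = _ := by ring
  have hfp : ∑ t ∈ T, f t ^ (p / (p - 1)) ≤
      2 ^ (m + 1) * ∑ K ∈ D.cells, volume.real K * |v K| ^ q := by
    have h1 : ∀ t, f t ^ (p / (p - 1)) = M t.2 * D.cellDist t.1 t.2 * |v t.1| ^ q := by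
      intro t
      rw [hf, Real.mul_rpow (Real.rpow_nonneg (hMd _ _) _) (Real.rpow_nonneg (abs_nonneg _) _),
        ← Real.rpow_mul (hMd _ _), ← Real.rpow_mul (abs_nonneg _), hr]
      have : (p - 1) / p * (p / (p - 1)) = 1 := by field_simp
      rw [this, Real.rpow_one]
    simp_rw [h1]
    rw [hT, Finset.sum_sigma, Finset.mul_sum]
    refine Finset.sum_le_sum fun K hK => ?_
    dsimp only
    rw [← Finset.sum_mul, ← mul_assoc]
    gcongr
    have h2 := ENNReal.toReal_mono (ENNReal.mul_ne_top (by simp) (volume_cell_ne_top hΩ hK))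
      (sum_edge_measure_mul_cellDist_le hK)
    rw [ENNReal.toReal_sum fun σ hσ => ENNReal.mul_ne_top
      (edge_measure_ne_top hΩ (D.edgesOf_subset K hK hσ)) ENNReal.ofReal_ne_top] at h2
    simpa [hM, Measure.real, ENNReal.toReal_ofReal cellDist_nonneg] using h2
  have hgp : (∑ t ∈ T, g t ^ p) ^ (1 / p) = D.discreteNorm p v := by
    have h1 : ∀ t, g t ^ p = M t.2 * D.cellDist t.1 t.2 *
        (D.jump v t.1 t.2 / D.edgeDist t.2) ^ p := by
      intro t
      rw [hg, Real.mul_rpow (Real.rpow_nonneg (hMd _ _) _) (hjd _ _), ← Real.rpow_mul (hMd _ _),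
        one_div_mul_cancel hp0.ne', Real.rpow_one]
    simp_rw [h1]
    rw [hT, Finset.sum_sigma]
    rfl
  calc _ = ∑ t ∈ T, M t.2 * (|v t.1| ^ r * D.jump v t.1 t.2) := by rw [hT, Finset.sum_sigma]
    _ ≤ ∑ t ∈ T, (1 + 1 / η) * (f t * g t) := Finset.sum_le_sum hterm
    _ = (1 + 1 / η) * ∑ t ∈ T, f t * g t := by rw [Finset.mul_sum]
    _ ≤ (1 + 1 / η) * ((∑ t ∈ T, f t ^ (p / (p - 1))) ^ (1 / (p / (p - 1))) *
        (∑ t ∈ T, g t ^ p) ^ (1 / p)) := by gcongr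
    _ ≤ _ := by
        rw [hgp, one_div_div]
        have hN : 0 ≤ D.discreteNorm p v := by
          rw [← hgp]
          exact Real.rpow_nonneg (Finset.sum_nonneg fun t ht => Real.rpow_nonneg (hg0 t ht) _) _
        gcongr
        exact Finset.sum_nonneg fun t ht => Real.rpow_nonneg (hf0 t ht) _

theorem discreteNorm_nonneg {p : ℝ} : 0 ≤ D.discreteNorm p v := by
  refine Real.rpow_nonneg (Finset.sum_nonneg fun K _ => Finset.sum_nonneg fun σ _ => ?_) _
  exact mul_nonneg (mul_nonneg measureReal_nonneg cellDist_nonneg)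
    (Real.rpow_nonneg (div_nonneg jump_nonneg edgeDist_nonneg) _)

theorem sum_cells_rpow_le_discreteNorm (hm : 0 < m) {p : ℝ} (hp : 1 < p) (hpm : p < m + 1)
    {η : ℝ} (hη : 0 < η) (hD : D.IsRegular η) (hΩ : Bornology.IsBounded Ω) {q : ℝ}
    (hq : q = p * (m + 1) / (m + 1 - p)) :
    (∑ K ∈ D.cells, volume.real K * |v K| ^ q) ^ (1 / q) ≤
      (m + 1) * (2 * (p * m / (m + 1 - p))) * (1 + 1 / η) * (2 ^ (m + 1)) ^ ((p - 1) / p) *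
        D.discreteNorm p v := by
  have hm' : (0 : ℝ) < m := Nat.cast_pos.2 hm
  have hp0 : 0 < p := by linarith
  have hp1 : 0 < p - 1 := by linarith
  have hmp : 0 < (m + 1 : ℝ) - p := by linarith
  -- This `γ` makes the exponent `q` appear on both sides: `γ (m + 1) / m = q` from the case `p = 1`
  -- and `(γ - 1) p / (p - 1) = q` from Hölder's inequality.
  set γ := p * m / (m + 1 - p) with hγdef
  have hγ : 1 ≤ γ := by
    rw [hγdef, le_div_iff₀ hmp]
    nlinarith
  have hq0 : 0 < q := by rw [hq]; positivity
  have hγq : γ * ((m + 1 : ℝ) / m) = q := by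
    rw [hq, hγdef]
    field_simp
  have hr : (γ - 1) * (p / (p - 1)) = q := by
    rw [hq, hγdef]
    field_simp
    ring
  have hexp : (m : ℝ) / (m + 1) - (p - 1) / p = 1 / q := by
    rw [hq]
    field_simp
    ring
  set A := ∑ K ∈ D.cells, volume.real K * |v K| ^ q with hA
  have hA0 : 0 ≤ A := Finset.sum_nonneg fun K _ => by positivity
  have hN := discreteNorm_nonneg (D := D) (v := v) (p := p)
  -- The final division by `A ^ ((p - 1) / p)` needs `A ≠ 0`.
  rcases hA0.eq_or_lt with h0 | hpos
  · rw [← h0, Real.zero_rpow (by positivity)]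
    positivity
  have h1 := sum_cells_rpow_le (D := D) (w := fun K => |v K| ^ γ) hm hΩ
  have hpow : ∀ K, |(|v K| ^ γ)| ^ ((m + 1 : ℝ) / m) = |v K| ^ q := by
    intro K
    rw [abs_of_nonneg (by positivity), ← Real.rpow_mul (abs_nonneg _), hγq]
  simp_rw [hpow] at h1
  have h2 : ∑ σ ∈ D.edges, ∑ K ∈ D.cellsOf σ,
        (Measure.euclideanHausdorffMeasure m).real σ * D.jump (fun K => |v K| ^ γ) K σ ≤
      2 * γ * ∑ K ∈ D.cells, ∑ σ ∈ D.edgesOf K,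
        (Measure.euclideanHausdorffMeasure m).real σ * (|v K| ^ (γ - 1) * D.jump v K σ) := by
    rw [sum_cells_edgesOf_eq, Finset.mul_sum]
    refine Finset.sum_le_sum fun σ hσ => ?_
    rw [← Finset.mul_sum, ← Finset.mul_sum, mul_left_comm]
    gcongr
    exact sum_jump_rpow_le hγ hσ
  have h3 := sum_measure_mul_jump_le (v := v) hp hη hD hΩ hr
  have h4 : A ^ ((m : ℝ) / (m + 1)) ≤ (m + 1) * (2 * γ * ((1 + 1 / η) *
      ((2 ^ (m + 1) * A) ^ ((p - 1) / p) * D.discreteNorm p v))) := by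
    refine h1.trans ?_
    gcongr
    refine h2.trans ?_
    gcongr
  rw [Real.mul_rpow (by positivity) hA0] at h4
  have hApos : 0 < A ^ ((p - 1) / p) := Real.rpow_pos_of_pos hpos _
  rw [← hexp, Real.rpow_sub hpos, div_le_iff₀ hApos]
  refine h4.trans_eq ?_
  ring

end Discretisation

theorem lemma5p2 (d : ℕ) (hd : 1 < d) (p : ℝ) (hp : 1 < p) (hpd : p < (d : ℝ))
    (η : ℝ) (hη : 0 < η) :
    ∃ C : ℝ, 0 < C ∧
      ∀ Ω : Set (EuclideanSpace ℝ (Fin d)),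
        IsOpen Ω → Bornology.IsBounded Ω → IsConnected Ω → HasPolyhedralBoundary Ω →
      ∀ D : Discretisation Ω, D.IsRegular η →
      ∀ (u : EuclideanSpace ℝ (Fin d) → ℝ) (v : Set (EuclideanSpace ℝ (Fin d)) → ℝ),
        D.HasCellValues u v →
        eLpNorm u (ENNReal.ofReal (p * d / (d - p))) (volume.restrict Ω) ≤
          ENNReal.ofReal (C * D.discreteNorm p v) := by
  obtain ⟨m, rfl⟩ : ∃ m, d = m + 1 := ⟨d - 1, by omega⟩
  have hm : 0 < m := by omega
  have hm' : (0 : ℝ) < m := Nat.cast_pos.2 hm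
  push_cast at hpd ⊢
  have hmp : 0 < (m + 1 : ℝ) - p := by linarith
  have hp0 : 0 < p := by linarith
  refine ⟨(m + 1) * (2 * (p * m / (m + 1 - p))) * (1 + 1 / η) * (2 ^ (m + 1)) ^ ((p - 1) / p),
    by positivity, ?_⟩
  intro Ω hΩo hΩb _ _ D hD u v hu
  set q := p * (m + 1) / (m + 1 - p) with hq
  have hq0 : 0 < q := by rw [hq]; positivity
  have hsum : 0 ≤ ∑ K ∈ D.cells, volume.real K * |v K| ^ q :=
    Finset.sum_nonneg fun K _ => by positivity
  rw [eLpNorm_congr_ae (Discretisation.ae_eq_cellFunction hΩo hu),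
    eLpNorm_eq_lintegral_rpow_enorm_toReal (by simpa using hq0) ENNReal.ofReal_ne_top,
    ENNReal.toReal_ofReal hq0.le]
  calc _ ≤ (∫⁻ x, ‖D.cellFunction v x‖ₑ ^ q) ^ (1 / q) := by
        gcongr
        -- The integral over `Ω` is bounded by the integral over the whole space.
        exact Measure.restrict_le_self
    _ = ENNReal.ofReal ((∑ K ∈ D.cells, volume.real K * |v K| ^ q) ^ (1 / q)) := by
        rw [Discretisation.lintegral_cellFunction_rpow hq0 hΩb,
          ENNReal.ofReal_rpow_of_nonneg hsum (by positivity)]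
    _ ≤ _ := ENNReal.ofReal_le_ofReal
        (Discretisation.sum_cells_rpow_le_discreteNorm hm hp hpd hη hD hΩb hq)
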